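/- Let $n,m\ge 1$ and let $\ell,\ell_1,\dots,\ell_n$ be positive integers. Put $\gamma=(\gamma_1,\dots,\gamma_n)=(\ell/\ell_1,\dots,\ell/\ell_n)$ and $\|\gamma\|=\gamma_1+\cdots+\gamma_n$. Let $$\mathcal L u=\sum_{\alpha\cdot\gamma=\ell}A_\alpha\,\partial^\alpha u$$ be a differential operator acting on functions $u:\mathbb R^n\to\mathbb C^m$, with constant coefficients $A_\alpha\in\mathbb C^{m\times m}$, of order $\ell=\max\{|\alpha| : A_\alpha\ne 0\}$, where $\alpha$ runs over multi-indices, $\alpha\cdot\gamma=\sum_k\alpha_k\gamma_k$ and $|\alpha|=\sum_k\alpha_k$. Assume that $\mathcal L$ is semielliptic, that is, its symbol $L(x)=\sum_{\alpha\cdot\gamma=\ell}A_\alpha (ix)^\alpha$ is an invertible matrix for every nonzero $x\in\mathbb R^n$. Let $\sigma(z)=\sum_{k=1}^n z_k^{2\ell_k}$ and define the $m\times m$ matrix functions $$J(x,t)=\int_{\mathbb R^n}e^{ix\cdot z}\,\sigma(z)\,e^{-t\sigma(z)}\,L(z)^{-1}\,dz\quad(x\in\mathbb R^n,\ t>0),\qquad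 F(x)=(2\pi)^{-n}\int_0^\infty J(x,t)\,dt\quad(x\ne0).$$ Theorem. Assume $\|\gamma\|>\ell$. Then $F$ is well defined: the integral for $J(x,t)$ converges absolutely for all $x\in\mathbb R^n$, $t>0$, and the integral for $F(x)$ converges absolutely for all $x\neq 0$. Moreover, for every $f\in C_0^\infty(\mathbb R^n,\mathbb C^m)$, the convolution integral $$\mathcal Sf(x)=(F*f)(x)=\int_{\mathbb R^n}F(x-y)f(y)\,dy$$ converges absolutely for every $x\in\mathbb R^n$, $\mathcal Sf\in C^\infty(\mathbb R^n,\mathbb C^m)$, and $\mathcal L(\mathcal Sf)=f$ on $\mathbb R^n$. (In this sense $F$ is a fundamental solution for $\mathcal L$.) -/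

import Mathlib

open scoped ContDiff

noncomputable section

namespace Semielliptic

/-- The vector `γ = (ℓ/ℓ₁, …, ℓ/ℓₙ)` of rational numbers. -/
def gam {n : ℕ} (l : ℕ) (lv : Fin n → ℕ) (k : Fin n) : ℚ :=
  (l : ℚ) / (lv k : ℚ)

/-- The norm `‖γ‖ = γ₁ + ⋯ + γₙ`. -/
def gamNorm {n : ℕ} (l : ℕ) (lv : Fin n → ℕ) : ℚ :=
  ∑ k, gam l lv k

/-- The symbol `L(x) = ∑_α (ix)^α A_α` of the operator with coefficients `A`.
The family `A` is finitely supported on the multi-indices. -/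
def symbol {n m : ℕ} (A : (Fin n → ℕ) →₀ Matrix (Fin m) (Fin m) ℂ)
    (x : EuclideanSpace ℝ (Fin n)) : Matrix (Fin m) (Fin m) ℂ :=
  A.sum fun α M => (∏ k, (Complex.I * (x k : ℂ)) ^ α k) • M

/-- The first order partial derivative `∂u/∂x_k`. -/
def pderiv {n m : ℕ} (k : Fin n) (u : EuclideanSpace ℝ (Fin n) → Fin m → ℂ) :
    EuclideanSpace ℝ (Fin n) → Fin m → ℂ :=
  fun x => lineDeriv ℝ u x (EuclideanSpace.single k (1 : ℝ))

/-- The derivative `∂^α u = ∂₁^{α₁} ⋯ ∂ₙ^{αₙ} u` for a multi-index `α`. -/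
def multiDeriv {n m : ℕ} (α : Fin n → ℕ) (u : EuclideanSpace ℝ (Fin n) → Fin m → ℂ) :
    EuclideanSpace ℝ (Fin n) → Fin m → ℂ :=
  (List.finRange n).foldr (fun k v => (pderiv k)^[α k] v) u

/-- The differential operator `ℒu = ∑_α A_α ∂^α u`. -/
def diffOp {n m : ℕ} (A : (Fin n → ℕ) →₀ Matrix (Fin m) (Fin m) ℂ)
    (u : EuclideanSpace ℝ (Fin n) → Fin m → ℂ) : EuclideanSpace ℝ (Fin n) → Fin m → ℂ :=
  fun x => A.sum fun α M => M.mulVec (multiDeriv α u x)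

/-- `ℒ = ∑_{α·γ = ℓ} A_α ∂^α` is a semielliptic operator of order `ℓ`, where
`γ = (ℓ/ℓ₁, …, ℓ/ℓₙ)`. -/
structure IsSemielliptic {n m : ℕ} (l : ℕ) (lv : Fin n → ℕ)
    (A : (Fin n → ℕ) →₀ Matrix (Fin m) (Fin m) ℂ) : Prop where
  /-- the order is positive -/
  order_pos : 0 < l
  /-- each `ℓ_k` is positive -/
  lv_pos : ∀ k, 0 < lv k
  /-- only multi-indices with `α·γ = ℓ` occur -/
  weight : ∀ α, A α ≠ 0 → ∑ k, (α k : ℚ) * gam l lv k = (l : ℚ)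
  /-- `ℓ = max {|α| : A_α ≠ 0}` -/
  order_eq : IsGreatest {d : ℕ | ∃ α, A α ≠ 0 ∧ d = ∑ k, α k} l
  /-- the symbol is invertible away from the origin -/
  symbol_isUnit : ∀ x, x ≠ 0 → IsUnit (symbol A x)

/-- `σ(x) = ∑_k x_k^{2ℓ_k}`. -/
def sigma {n : ℕ} (lv : Fin n → ℕ) (x : EuclideanSpace ℝ (Fin n)) : ℝ :=
  ∑ k, x k ^ (2 * lv k)

/-- The matrix `e^{ix·z} σ(z) e^{-tσ(z)} L(z)⁻¹`. -/
def kernelIntegrand {n m : ℕ} (lv : Fin n → ℕ) (A : (Fin n → ℕ) →₀ Matrix (Fin m) (Fin m) ℂ)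
    (x : EuclideanSpace ℝ (Fin n)) (t : ℝ) (z : EuclideanSpace ℝ (Fin n)) :
    Matrix (Fin m) (Fin m) ℂ :=
  (Complex.exp (Complex.I * ((∑ k, x k * z k : ℝ) : ℂ)) * (sigma lv z : ℂ) *
    Complex.exp (-((t * sigma lv z : ℝ) : ℂ))) • (symbol A z)⁻¹

/-- `J(x,t) = ∫ e^{ix·z} σ(z) e^{-tσ(z)} L(z)⁻¹ dz`, the integral being taken entrywise. -/
def kernelJ {n m : ℕ} (lv : Fin n → ℕ) (A : (Fin n → ℕ) →₀ Matrix (Fin m) (Fin m) ℂ)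
    (x : EuclideanSpace ℝ (Fin n)) (t : ℝ) : Matrix (Fin m) (Fin m) ℂ :=
  Matrix.of fun i j => ∫ z, kernelIntegrand lv A x t z i j

/-- `F(x) = (2π)^{-n} ∫₀^∞ J(x,t) dt` for `x ≠ 0`, the integral being taken entrywise.
(The value that the formula happens to give at `x = 0` has no meaning.) -/
def fundSol {n m : ℕ} (lv : Fin n → ℕ) (A : (Fin n → ℕ) →₀ Matrix (Fin m) (Fin m) ℂ)
    (x : EuclideanSpace ℝ (Fin n)) : Matrix (Fin m) (Fin m) ℂ :=
  Matrix.of fun i j =>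
    (((2 * Real.pi) ^ n : ℝ) : ℂ)⁻¹ * ∫ t in Set.Ioi (0 : ℝ), kernelJ lv A x t i j

/-- `𝒮f(x) = (F * f)(x) = ∫ F(x - y) f(y) dy`. -/
def opS {n m : ℕ} (lv : Fin n → ℕ) (A : (Fin n → ℕ) →₀ Matrix (Fin m) (Fin m) ℂ)
    (f : EuclideanSpace ℝ (Fin n) → Fin m → ℂ) : EuclideanSpace ℝ (Fin n) → Fin m → ℂ :=
  fun x => ∫ y, (fundSol lv A (x - y)).mulVec (f y)

end Semielliptic

end

noncomputable section

namespace Semielliptic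

/-! ### Anisotropic dilations and homogeneous functions. -/

section

open MeasureTheory Set Filter Topology

variable {n : ℕ}

/-! Clearing denominators in `γ` gives integer weights `wt`, for which `L` is homogeneous of degree
W = `totalWt` and `σ` of degree 2W. The condition `‖γ‖ > ℓ` becomes Q > W for the homogeneous
dimension Q = `homDim`. An entry of `L⁻¹`, called `ℓ` below, is homogeneous of degree -W, and the
matching entry of `J(x,t)` is `osc` of `σℓ`.

Formally, ∫₀^∞ σ e^{-tσ} dt = 1 away from the origin, so `F` is the inverse Fourier transform of
`L⁻¹`; the work lies in the interchanges of integrals. For large t, scaling gives |J(x,t)| ≤ C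
t^{-(W+Q)/(2W)} uniformly in x, and the exponent exceeds 1 exactly because Q > W. For small t, decay
in x is needed, from integration by parts in z; but `σℓ` is not smooth at the origin, which limits
the number of steps. `IsInvHom.osc_eq_integral` removes the limit: σ e^{-tσ} is a time integral of
r^p σ^{p+2} e^{-(t+r)σ}, and σ^{p+2}ℓ has as high a degree as desired. Together with
`IsHom.exists_osc_bound` this yields convergence of the integral for `F(x)` at x ≠ 0
(`IsInvHom.integrableOn_osc`) and an L¹ bound O(t^{-1/2}) for `J(·,t)`
(`IsInvHom.exists_integral_osc_le`).

The L¹ bound near t = 0 and the uniform bound near infinity justify Fubini for `F * f`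
(`IsInvHom.integral_conv`); a second use of Fubini carries out the time integral in frequency space
(`IsInvHom.integral_time`). Hence `𝒮f` is the inverse transform of L⁻¹ times the transform of f.
That function has all moments, so `𝒮f` is smooth, `ℒ` acts as multiplication by `L`, and Fourier
inversion returns f. -/

/-- The product of all `ℓ_k`; the symbol is homogeneous of this degree. -/
def totalWt (lv : Fin n → ℕ) : ℕ := ∏ k, lv k

/-- The integer weight of the `k`-th coordinate, proportional to `γ_k`. -/
def wt (lv : Fin n → ℕ) (k : Fin n) : ℕ := ∏ j ∈ Finset.univ.erase k, lv j

/-- The homogeneous dimension. -/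
def homDim (lv : Fin n → ℕ) : ℕ := ∑ k, wt lv k

lemma wt_mul (lv : Fin n → ℕ) (k : Fin n) : wt lv k * lv k = totalWt lv :=
  Finset.prod_erase_mul _ _ (Finset.mem_univ k)

lemma wt_pos {lv : Fin n → ℕ} (hlv : ∀ k, 0 < lv k) (k : Fin n) : 0 < wt lv k :=
  Finset.prod_pos fun j _ => hlv j

lemma totalWt_pos {lv : Fin n → ℕ} (hlv : ∀ k, 0 < lv k) : 0 < totalWt lv :=
  Finset.prod_pos fun j _ => hlv j

lemma wt_le_totalWt {lv : Fin n → ℕ} (hlv : ∀ k, 0 < lv k) (k : Fin n) :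
    wt lv k ≤ totalWt lv := by
  rw [← wt_mul lv k]; exact Nat.le_mul_of_pos_right _ (hlv k)

/-- The anisotropic dilation `z ↦ (r^{w_k} z_k)`. -/
def dil (lv : Fin n → ℕ) (r : ℝ) (z : EuclideanSpace ℝ (Fin n)) : EuclideanSpace ℝ (Fin n) :=
  WithLp.toLp 2 fun k => r ^ wt lv k * z k

@[simp] lemma dil_apply (lv : Fin n → ℕ) (r : ℝ) (z : EuclideanSpace ℝ (Fin n)) (k : Fin n) :
    dil lv r z k = r ^ wt lv k * z k := rfl

lemma dil_add_smul_single (lv : Fin n → ℕ) (r : ℝ) (z : EuclideanSpace ℝ (Fin n)) (k : Fin n)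
    (t : ℝ) : dil lv r (z + t • EuclideanSpace.single k (1 : ℝ)) =
      dil lv r z + (r ^ wt lv k * t) • EuclideanSpace.single k (1 : ℝ) := by
  ext j
  by_cases h : j = k
  · subst h; simp; ring
  · simp [h]

lemma sigma_nonneg (lv : Fin n → ℕ) (z : EuclideanSpace ℝ (Fin n)) : 0 ≤ sigma lv z :=
  Finset.sum_nonneg fun k _ => by rw [pow_mul]; positivity

lemma pow_le_sigma (lv : Fin n → ℕ) (z : EuclideanSpace ℝ (Fin n)) (k : Fin n) :
    z k ^ (2 * lv k) ≤ sigma lv z :=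
  Finset.single_le_sum (f := fun k => z k ^ (2 * lv k))
    (fun k _ => by rw [pow_mul]; positivity) (Finset.mem_univ k)

lemma sigma_pos (lv : Fin n → ℕ) {z : EuclideanSpace ℝ (Fin n)} (hz : z ≠ 0) :
    0 < sigma lv z := by
  obtain ⟨k, hk⟩ : ∃ k, z k ≠ 0 := by
    contrapose! hz
    ext k; simp [hz k]
  refine lt_of_lt_of_le ?_ (pow_le_sigma lv z k)
  rw [pow_mul]; positivity

lemma sigma_zero {lv : Fin n → ℕ} (hlv : ∀ k, 0 < lv k) :
    sigma lv (0 : EuclideanSpace ℝ (Fin n)) = 0 :=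
  Finset.sum_eq_zero fun k _ => by simp [(hlv k).ne']

lemma sigma_dil (lv : Fin n → ℕ) (r : ℝ) (z : EuclideanSpace ℝ (Fin n)) :
    sigma lv (dil lv r z) = r ^ (2 * totalWt lv) * sigma lv z := by
  simp only [sigma, Finset.mul_sum, dil_apply]
  refine Finset.sum_congr rfl fun k _ => ?_
  rw [mul_pow, ← pow_mul, ← wt_mul lv k]; ring_nf

lemma contDiff_coord {N : WithTop ℕ∞} (k : Fin n) :
    ContDiff ℝ N fun z : EuclideanSpace ℝ (Fin n) => z k :=
  contDiff_euclidean.1 contDiff_id k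

lemma contDiff_sigma (lv : Fin n → ℕ) : ContDiff ℝ ∞ (sigma lv) :=
  ContDiff.sum fun k _ => (contDiff_coord k).pow _

lemma continuous_sigma (lv : Fin n → ℕ) : Continuous (sigma lv) := (contDiff_sigma lv).continuous

lemma isCompact_sigma_eq_one {lv : Fin n → ℕ} (hlv : ∀ k, 0 < lv k) :
    IsCompact {z : EuclideanSpace ℝ (Fin n) | sigma lv z = 1} := by
  refine Metric.isCompact_of_isClosed_isBounded
    (isClosed_eq (continuous_sigma lv) continuous_const) ?_
  refine (Metric.isBounded_closedBall (x := (0 : EuclideanSpace ℝ (Fin n))) (r := √n)).subset ?_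
  intro z hz
  rw [mem_closedBall_zero_iff, EuclideanSpace.norm_eq]
  refine Real.sqrt_le_sqrt ?_
  calc ∑ k, ‖z k‖ ^ 2 ≤ ∑ k : Fin n, (1 : ℝ) := by
        refine Finset.sum_le_sum fun k _ => ?_
        have h : (‖z k‖ ^ 2) ^ lv k ≤ 1 := by
          rw [← hz.out, Real.norm_eq_abs, sq_abs, ← pow_mul]
          exact pow_le_sigma lv z k
        by_contra! hc
        exact absurd h (not_le.2 (one_lt_pow₀ hc (hlv k).ne'))
    _ = n := by simp

/-- `g` is smooth away from the origin and homogeneous of degree `d` for the dilations `dil`. -/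
structure IsHom (lv : Fin n → ℕ) (d : ℕ) (g : EuclideanSpace ℝ (Fin n) → ℂ) : Prop where
  smooth : ContDiffOn ℝ ∞ g {0}ᶜ
  hom : ∀ r : ℝ, 0 < r → ∀ z, g (dil lv r z) = (r : ℂ) ^ d * g z

namespace IsHom

variable {lv : Fin n → ℕ} {d e : ℕ} {g h : EuclideanSpace ℝ (Fin n) → ℂ}

lemma mul (hg : IsHom lv d g) (hh : IsHom lv e h) : IsHom lv (d + e) fun z => g z * h z where
  smooth := hg.smooth.mul hh.smooth
  hom r hr z := by rw [hg.hom r hr, hh.hom r hr]; ring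

lemma measurable (hg : IsHom lv d g) : Measurable g :=
  measurable_of_continuousOn_compl_singleton 0 hg.smooth.continuousOn

/-- Dilations fix the origin, so g(0) = 2^d g(0). -/
lemma apply_zero (hg : IsHom lv d g) (hd : 0 < d) : g 0 = 0 := by
  have h := hg.hom 2 two_pos 0
  have h0 : dil lv 2 (0 : EuclideanSpace ℝ (Fin n)) = 0 := by ext k; simp
  rw [h0] at h
  have h2 : (1 - (2 : ℂ) ^ d) * g 0 = 0 := by push_cast at h; linear_combination h
  rcases mul_eq_zero.1 h2 with h3 | h3
  · exfalso
    have h4 : (2 : ℂ) ^ d = 1 := by linear_combination -h3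
    have h5 : (2 : ℕ) ^ d = 1 := by exact_mod_cast h4
    exact absurd h5 (Nat.one_lt_two_pow hd.ne').ne'
  · exact h3

/-- On the compact set `σ = 1`, which avoids the origin, g is bounded; homogeneity carries the bound
to all other points. -/
lemma exists_bound (hlv : ∀ k, 0 < lv k) (hg : IsHom lv d g) (hd : 0 < d) :
    ∃ C, 0 ≤ C ∧ ∀ z, ‖g z‖ ≤ C * sigma lv z ^ ((d : ℝ) / (2 * totalWt lv)) := by
  have hW : (0 : ℝ) < totalWt lv := by exact_mod_cast totalWt_pos hlv
  obtain ⟨C, hC⟩ := (isCompact_sigma_eq_one hlv).exists_bound_of_continuousOn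
    (f := g) (hg.smooth.continuousOn.mono fun z hz h0 => by
      have h1 : sigma lv z = 1 := hz
      rw [mem_singleton_iff.1 h0, sigma_zero hlv] at h1
      exact zero_ne_one h1)
  refine ⟨max C 0, le_max_right _ _, fun z => ?_⟩
  rcases eq_or_ne z 0 with rfl | hz
  · rw [hg.apply_zero hd, norm_zero]
    have := sigma_nonneg lv (0 : EuclideanSpace ℝ (Fin n))
    positivity
  have hs := sigma_pos lv hz
  -- The dilation factor that moves z onto the surface `σ = 1`.
  set r : ℝ := sigma lv z ^ (-(1 : ℝ) / (2 * totalWt lv)) with hr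
  have hr0 : 0 < r := Real.rpow_pos_of_pos hs _
  have h1 : sigma lv (dil lv r z) = 1 := by
    rw [sigma_dil, hr, ← Real.rpow_natCast, ← Real.rpow_mul hs.le]
    have : -(1 : ℝ) / (2 * totalWt lv) * ((2 * totalWt lv : ℕ) : ℝ) = -1 := by
      push_cast; field_simp
    rw [this, Real.rpow_neg_one, inv_mul_cancel₀ hs.ne']
  have h2 := hC _ h1
  rw [hg.hom r hr0, norm_mul, norm_pow, Complex.norm_real, Real.norm_of_nonneg hr0.le] at h2
  have h3 : r ^ d * sigma lv z ^ ((d : ℝ) / (2 * totalWt lv)) = 1 := by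
    rw [hr, ← Real.rpow_natCast, ← Real.rpow_mul hs.le, ← Real.rpow_add hs,
      show -(1 : ℝ) / (2 * totalWt lv) * d + d / (2 * totalWt lv) = 0 by ring, Real.rpow_zero]
  have h4 : 0 < sigma lv z ^ ((d : ℝ) / (2 * totalWt lv)) := Real.rpow_pos_of_pos hs _
  calc ‖g z‖ = (r ^ d * ‖g z‖) * sigma lv z ^ ((d : ℝ) / (2 * totalWt lv)) := by
        rw [mul_right_comm, h3, one_mul]
    _ ≤ max C 0 * sigma lv z ^ ((d : ℝ) / (2 * totalWt lv)) := by
        gcongr; exact h2.trans (le_max_left _ _)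

/-- Only the origin needs an argument. Along the k-th axis σ^{d/(2W)} equals |t|^{d/w_k}, so g is
O(t²) there and its derivative exists. Integration by parts requires the derivative at every point,
including this one. -/
lemma hasLineDerivAt (hlv : ∀ k, 0 < lv k) (hg : IsHom lv d g) {k : Fin n}
    (hd : 2 * wt lv k ≤ d) (z : EuclideanSpace ℝ (Fin n)) :
    HasLineDerivAt ℝ g (lineDeriv ℝ g z (EuclideanSpace.single k (1 : ℝ))) z
      (EuclideanSpace.single k (1 : ℝ)) := by
  refine LineDifferentiableAt.hasLineDerivAt ?_
  rcases eq_or_ne z 0 with rfl | hz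
  · have hd0 : 0 < d := lt_of_lt_of_le (by have := wt_pos hlv k; omega) hd
    obtain ⟨C, hC0, hC⟩ := hg.exists_bound hlv hd0
    have hW : (0 : ℝ) < totalWt lv := by exact_mod_cast totalWt_pos hlv
    have key : ∀ᶠ t : ℝ in 𝓝 0, ‖g (0 + t • EuclideanSpace.single k (1 : ℝ))‖ ≤ C * ‖‖t - 0‖ ^ 2‖ := by
      have : ∀ᶠ t : ℝ in 𝓝 0, t ∈ Metric.ball (0 : ℝ) 1 := Metric.ball_mem_nhds _ one_pos
      filter_upwards [this] with t ht
      have ht1 : |t| ≤ 1 := by simpa using (mem_ball_zero_iff.1 ht).le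
      have hs : sigma lv (0 + t • EuclideanSpace.single k (1 : ℝ)) = |t| ^ (2 * lv k) := by
        rw [sigma, Finset.sum_eq_single k]
        · simp [pow_mul]
        · intro j _ hj
          simp [hj, (hlv j).ne']
        · simp
      refine (hC _).trans ?_
      rw [hs]
      gcongr
      rw [norm_pow, norm_norm, sub_zero, Real.norm_eq_abs, ← Real.rpow_natCast, ← Real.rpow_mul (abs_nonneg t),
        ← Real.rpow_natCast]
      rcases (abs_nonneg t).eq_or_lt with h0 | h0
      · rw [← h0, Real.zero_rpow, Real.zero_rpow]
        · simp
        · have : (0 : ℝ) < d := by exact_mod_cast hd0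
          have : (0 : ℝ) < lv k := by exact_mod_cast hlv k
          push_cast; positivity
      · refine Real.rpow_le_rpow_of_exponent_ge h0 ht1 ?_
        rw [mul_div_assoc', le_div_iff₀ (by positivity)]
        have : 2 * (2 * totalWt lv) ≤ 2 * lv k * d := by
          rw [← wt_mul lv k]; nlinarith [hlv k]
        exact_mod_cast this
    have hO : (fun t : ℝ => g (0 + t • EuclideanSpace.single k (1 : ℝ))) =O[𝓝 0]
        fun t => ‖t - 0‖ ^ 2 := Asymptotics.IsBigO.of_bound C key
    exact (hO.hasFDerivAt one_lt_two).differentiableAt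
  · exact ((hg.smooth.contDiffAt (isOpen_compl_singleton.mem_nhds hz)).differentiableAt
      (by simp)).lineDifferentiableAt

lemma lineDeriv_single (hg : IsHom lv d g) {k : Fin n} (hd : wt lv k ≤ d) :
    IsHom lv (d - wt lv k) fun z => lineDeriv ℝ g z (EuclideanSpace.single k (1 : ℝ)) where
  smooth := by
    have h1 : ContDiffOn ℝ ∞ (fun z => fderiv ℝ g z (EuclideanSpace.single k (1 : ℝ))) {0}ᶜ :=
      (hg.smooth.fderiv_of_isOpen isOpen_compl_singleton (by simp)).clm_apply contDiffOn_const
    refine h1.congr fun z hz => ?_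
    exact ((hg.smooth.contDiffAt (isOpen_compl_singleton.mem_nhds hz)).differentiableAt
      (by simp)).lineDeriv_eq_fderiv
  hom r hr z := by
    have hr' : ((r : ℂ) ^ wt lv k) ≠ 0 := pow_ne_zero _ (by exact_mod_cast hr.ne')
    simp only [lineDeriv]
    set e : EuclideanSpace ℝ (Fin n) := EuclideanSpace.single k (1 : ℝ) with he
    have h1 : (fun t : ℝ => g (dil lv r z + (r ^ wt lv k * t) • e)) =
        fun t => (r : ℂ) ^ d * g (z + t • e) := by
      funext t
      rw [← hg.hom r hr, he, dil_add_smul_single]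
    have h2 := congrArg (fun u : ℝ → ℂ => deriv u 0) h1
    -- Both rules for `deriv` hold without differentiability, so the homogeneity of the derivative
    -- includes the origin.
    rw [deriv_const_mul_field, deriv_comp_mul_left (f := fun t : ℝ => g (dil lv r z + t • e)),
      mul_zero, Complex.real_smul] at h2
    push_cast at h2
    apply mul_left_cancel₀ hr'
    rw [h2, ← mul_assoc, ← pow_add, Nat.add_sub_cancel' hd]

lemma of_sigma (lv : Fin n → ℕ) : IsHom lv (2 * totalWt lv) fun z => (sigma lv z : ℂ) where
  smooth := (Complex.ofRealCLM.contDiff.comp (contDiff_sigma lv)).contDiffOn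
  hom r hr z := by rw [sigma_dil]; push_cast; rfl

end IsHom

end

/-! ### Damped oscillatory integrals and integration by parts. -/

section

open MeasureTheory Set Filter Topology

variable {n : ℕ}

/-- Serves both e^{-sσ}, which factors over the coordinates, and the product of Cauchy kernels that
dominates `osc` in x. -/
lemma integrable_prod_scale (h : Fin n → ℝ → ℝ) (hh : ∀ k, Integrable (h k)) {c : Fin n → ℝ}
    (hc : ∀ k, 0 < c k) :
    Integrable (fun z : EuclideanSpace ℝ (Fin n) => ∏ k, h k (c k * z k)) ∧
    ∫ z : EuclideanSpace ℝ (Fin n), ∏ k, h k (c k * z k) =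
      (∏ k, (c k)⁻¹) * ∏ k, ∫ x, h k x := by
  have hmp := PiLp.volume_preserving_ofLp (Fin n)
  have hemb : MeasurableEmbedding (@WithLp.ofLp 2 (Fin n → ℝ)) :=
    (MeasurableEquiv.toLp 2 (Fin n → ℝ)).symm.measurableEmbedding
  constructor
  · have h1 : Integrable (fun x : Fin n → ℝ => ∏ k, h k (c k * x k)) := by
      refine Integrable.fintype_prod (f := fun k x => h k (c k * x)) fun k => ?_
      exact (hh k).comp_mul_left' (hc k).ne'
    exact (hmp.integrable_comp_emb hemb).2 h1
  · have h2 := hmp.integral_comp hemb (fun x : Fin n → ℝ => ∏ k, h k (c k * x k))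
    refine h2.trans ?_
    rw [integral_fintype_prod_volume_eq_prod (fun k x => h k (c k * x)), ← Finset.prod_mul_distrib]
    refine Finset.prod_congr rfl fun k _ => ?_
    rw [Measure.integral_comp_mul_left, smul_eq_mul, abs_of_pos (inv_pos.2 (hc k))]

lemma integrable_exp_neg_even_pow {p : ℕ} (hp : 0 < p) :
    Integrable fun x : ℝ => Real.exp (-x ^ (2 * p)) := by
  refine ((integrable_exp_neg_mul_sq one_pos).const_mul (Real.exp 1)).mono'
    (by fun_prop) (ae_of_all _ fun x => ?_)
  rw [Real.norm_of_nonneg (Real.exp_pos _).le, ← Real.exp_add]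
  refine Real.exp_le_exp.2 ?_
  have h1 : x ^ 2 - 1 ≤ x ^ (2 * p) := by
    rw [pow_mul]
    have h0 := sq_nonneg x
    rcases le_total (x ^ 2) 1 with h | h
    · have := pow_nonneg h0 p
      linarith
    · have := le_self_pow₀ h hp.ne'
      linarith
  linarith

/-- The length scale of the `k`-th coordinate at time `s⁻¹`. -/
def scl (lv : Fin n → ℕ) (s : ℝ) (k : Fin n) : ℝ := s ^ ((wt lv k : ℝ) / (2 * totalWt lv))

lemma scl_pos (lv : Fin n → ℕ) {s : ℝ} (hs : 0 < s) (k : Fin n) : 0 < scl lv s k :=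
  Real.rpow_pos_of_pos hs _

lemma prod_scl (lv : Fin n → ℕ) {s : ℝ} (hs : 0 < s) :
    ∏ k, scl lv s k = s ^ ((homDim lv : ℝ) / (2 * totalWt lv)) := by
  simp only [scl]
  rw [← Real.rpow_sum_of_pos hs, ← Finset.sum_div, homDim, Nat.cast_sum]

lemma exp_neg_sigma_eq {lv : Fin n → ℕ} (hlv : ∀ k, 0 < lv k) {s : ℝ} (hs : 0 < s)
    (z : EuclideanSpace ℝ (Fin n)) :
    Real.exp (-(s * sigma lv z)) = ∏ k, Real.exp (-(scl lv s k * z k) ^ (2 * lv k)) := by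
  rw [← Real.exp_sum, sigma, Finset.sum_neg_distrib, Finset.mul_sum]
  congr 2
  refine Finset.sum_congr rfl fun k _ => ?_
  have hW : (totalWt lv : ℝ) ≠ 0 := by exact_mod_cast (totalWt_pos hlv).ne'
  rw [mul_pow, scl, ← Real.rpow_mul_natCast hs.le]
  have : (wt lv k : ℝ) / (2 * totalWt lv) * ((2 * lv k : ℕ) : ℝ) = 1 := by
    have h := wt_mul lv k
    rw [← h]
    have h1 : (wt lv k : ℝ) ≠ 0 := by exact_mod_cast (wt_pos hlv k).ne'
    have h2 : (lv k : ℝ) ≠ 0 := by exact_mod_cast (hlv k).ne'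
    push_cast; field_simp
  rw [this, Real.rpow_one]

lemma integrable_exp_neg_sigma {lv : Fin n → ℕ} (hlv : ∀ k, 0 < lv k) {s : ℝ} (hs : 0 < s) :
    Integrable fun z : EuclideanSpace ℝ (Fin n) => Real.exp (-(s * sigma lv z)) := by
  simp_rw [exp_neg_sigma_eq hlv hs]
  exact (integrable_prod_scale (fun k x => Real.exp (-x ^ (2 * lv k)))
    (fun k => integrable_exp_neg_even_pow (hlv k)) (scl_pos lv hs)).1

lemma exists_integral_exp_neg_sigma {lv : Fin n → ℕ} (hlv : ∀ k, 0 < lv k) :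
    ∃ C : ℝ, 0 ≤ C ∧ ∀ s, 0 < s → ∫ z : EuclideanSpace ℝ (Fin n), Real.exp (-(s * sigma lv z)) =
      C * s ^ (-((homDim lv : ℝ) / (2 * totalWt lv))) := by
  refine ⟨∏ k, ∫ x : ℝ, Real.exp (-x ^ (2 * lv k)), Finset.prod_nonneg fun k _ =>
    integral_nonneg fun x => (Real.exp_pos _).le, fun s hs => ?_⟩
  simp_rw [exp_neg_sigma_eq hlv hs]
  rw [(integrable_prod_scale (fun k x => Real.exp (-x ^ (2 * lv k)))
    (fun k => integrable_exp_neg_even_pow (hlv k)) (scl_pos lv hs)).2, Finset.prod_inv_distrib,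
    prod_scl lv hs, Real.rpow_neg hs.le, mul_comm]

/-- With u = sσ(z), half of the exponential absorbs the polynomial growth of g and the other half
remains integrable in z. -/
lemma exists_rpow_mul_exp_bound {e : ℝ} (he : 0 ≤ e) :
    ∃ C : ℝ, 0 ≤ C ∧ ∀ u, 0 ≤ u → u ^ e * Real.exp (-u) ≤ C * Real.exp (-(1 / 2 * u)) := by
  -- With k = ⌈e⌉: u^e ≤ u^k + 1, while u^k ≤ k! 2^k e^{u/2} by the exponential series and 1 ≤
  -- e^{u/2}.
  refine ⟨(Nat.factorial ⌈e⌉₊ : ℝ) * 2 ^ ⌈e⌉₊ + 1, by positivity, fun u hu => ?_⟩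
  have h1 : Real.exp (-u) = Real.exp (-(1 / 2 * u)) * Real.exp (-(1 / 2 * u)) := by
    rw [← Real.exp_add]; ring_nf
  rw [h1, ← mul_assoc]
  refine mul_le_mul_of_nonneg_right ?_ (Real.exp_pos _).le
  rw [Real.exp_neg, ← div_eq_mul_inv, div_le_iff₀ (Real.exp_pos _)]
  have h2 := Real.pow_div_factorial_le_exp (1 / 2 * u) (by positivity) ⌈e⌉₊
  have h3 : (1 : ℝ) ≤ Real.exp (1 / 2 * u) := Real.one_le_exp (by positivity)
  have h4 : u ^ e ≤ u ^ ⌈e⌉₊ + 1 := by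
    rcases le_total u 1 with h | h
    · have := Real.rpow_le_one hu h he
      have := pow_nonneg hu ⌈e⌉₊
      linarith
    · have : u ^ e ≤ u ^ (⌈e⌉₊ : ℝ) := Real.rpow_le_rpow_of_exponent_le h (Nat.le_ceil e)
      rw [Real.rpow_natCast] at this
      linarith
  rw [div_le_iff₀ (by positivity), mul_pow, one_div, inv_pow] at h2
  have h5 : u ^ ⌈e⌉₊ ≤ (Nat.factorial ⌈e⌉₊ : ℝ) * 2 ^ ⌈e⌉₊ * Real.exp (1 / 2 * u) := by
    have h6 : (2 : ℝ) ^ ⌈e⌉₊ ≠ 0 := by positivity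
    calc u ^ ⌈e⌉₊ = 2 ^ ⌈e⌉₊ * ((2 ^ ⌈e⌉₊)⁻¹ * u ^ ⌈e⌉₊) := by field_simp
      _ ≤ 2 ^ ⌈e⌉₊ * (Real.exp (1 / 2 * u) * (Nat.factorial ⌈e⌉₊ : ℝ)) := by
        rw [one_div]; exact mul_le_mul_of_nonneg_left h2 (by positivity)
      _ = _ := by ring
  linarith

/-- The exponent of decay in time of the integral of a function of degree `d`. -/
def decay (lv : Fin n → ℕ) (d : ℕ) : ℝ := ((d : ℝ) + homDim lv) / (2 * totalWt lv)

/-- The pure phase `e^{ix·z}`. -/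
def phase (x z : EuclideanSpace ℝ (Fin n)) : ℂ :=
  Complex.exp (Complex.I * ((∑ k, x k * z k : ℝ) : ℂ))

@[simp] lemma norm_phase (x z : EuclideanSpace ℝ (Fin n)) : ‖phase x z‖ = 1 := by
  rw [phase, mul_comm, Complex.norm_exp_ofReal_mul_I]

lemma continuous_phase :
    Continuous fun p : EuclideanSpace ℝ (Fin n) × EuclideanSpace ℝ (Fin n) => phase p.1 p.2 := by
  unfold phase; fun_prop

lemma continuous_phase_right (x : EuclideanSpace ℝ (Fin n)) : Continuous (phase x) :=
  continuous_phase.comp (Continuous.prodMk_right x)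

lemma phase_sub (x y z : EuclideanSpace ℝ (Fin n)) : phase (x - y) z = phase x z * phase (-y) z := by
  simp only [phase, ← Complex.exp_add, ← mul_add]
  congr 2
  rw [← Complex.ofReal_add, ← Finset.sum_add_distrib]
  congr 1
  refine Finset.sum_congr rfl fun k _ => ?_
  simp; ring

/-- The factor `e^{-sσ(z)}`. -/
def damp (lv : Fin n → ℕ) (s : ℝ) (z : EuclideanSpace ℝ (Fin n)) : ℂ :=
  (Real.exp (-(s * sigma lv z)) : ℂ)

lemma norm_damp (lv : Fin n → ℕ) (s : ℝ) (z : EuclideanSpace ℝ (Fin n)) :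
    ‖damp lv s z‖ = Real.exp (-(s * sigma lv z)) := by
  rw [damp, Complex.norm_real, Real.norm_of_nonneg (Real.exp_pos _).le]

lemma continuous_damp (lv : Fin n → ℕ) :
    Continuous fun p : ℝ × EuclideanSpace ℝ (Fin n) => damp lv p.1 p.2 := by
  have := continuous_sigma lv
  unfold damp; fun_prop

lemma continuous_damp_right (lv : Fin n → ℕ) (s : ℝ) : Continuous (damp lv s) :=
  (continuous_damp lv).comp (Continuous.prodMk_right s)

/-- The oscillatory integral `∫ e^{ix·z} g(z) e^{-sσ(z)} dz`. -/
def osc (lv : Fin n → ℕ) (g : EuclideanSpace ℝ (Fin n) → ℂ) (x : EuclideanSpace ℝ (Fin n))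
    (s : ℝ) : ℂ :=
  ∫ z, phase x z * (g z * damp lv s z)

variable {lv : Fin n → ℕ} {d : ℕ} {g : EuclideanSpace ℝ (Fin n) → ℂ}

lemma IsHom.exists_damp_bound (hlv : ∀ k, 0 < lv k) (hg : IsHom lv d g) (hd : 0 < d) :
    ∃ C : ℝ, 0 ≤ C ∧ ∀ s, 0 < s → ∀ z, ‖g z * damp lv s z‖ ≤
      C * s ^ (-((d : ℝ) / (2 * totalWt lv))) * Real.exp (-(1 / 2 * s * sigma lv z)) := by
  obtain ⟨C, hC0, hC⟩ := hg.exists_bound hlv hd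
  obtain ⟨D, hD0, hD⟩ := exists_rpow_mul_exp_bound (e := (d : ℝ) / (2 * totalWt lv)) (by positivity)
  refine ⟨C * D, by positivity, fun s hs z => ?_⟩
  have hσ := sigma_nonneg lv z
  have h1 := hD (s * sigma lv z) (by positivity)
  rw [Real.mul_rpow hs.le hσ] at h1
  have hp : s ^ (-((d : ℝ) / (2 * totalWt lv))) * s ^ ((d : ℝ) / (2 * totalWt lv)) = 1 := by
    rw [← Real.rpow_add hs, neg_add_cancel, Real.rpow_zero]
  rw [norm_mul, norm_damp]
  calc ‖g z‖ * Real.exp (-(s * sigma lv z))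
      ≤ C * sigma lv z ^ ((d : ℝ) / (2 * totalWt lv)) * Real.exp (-(s * sigma lv z)) := by
        gcongr; exact hC z
    _ = C * s ^ (-((d : ℝ) / (2 * totalWt lv))) * (s ^ ((d : ℝ) / (2 * totalWt lv)) *
        sigma lv z ^ ((d : ℝ) / (2 * totalWt lv)) * Real.exp (-(s * sigma lv z))) := by
        linear_combination (- C * sigma lv z ^ ((d : ℝ) / (2 * totalWt lv)) *
          Real.exp (-(s * sigma lv z))) * hp
    _ ≤ C * s ^ (-((d : ℝ) / (2 * totalWt lv))) * (D * Real.exp (-(1 / 2 * (s * sigma lv z)))) := by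
        have : 0 ≤ s ^ (-((d : ℝ) / (2 * totalWt lv))) := Real.rpow_nonneg hs.le _
        gcongr
    _ = _ := by ring_nf

lemma IsHom.integrable_damp (hlv : ∀ k, 0 < lv k) (hg : IsHom lv d g) (hd : 0 < d) {s : ℝ}
    (hs : 0 < s) : Integrable fun z => g z * damp lv s z := by
  obtain ⟨C, hC0, hC⟩ := hg.exists_damp_bound hlv hd
  exact ((integrable_exp_neg_sigma hlv (by positivity : 0 < 1 / 2 * s)).const_mul _).mono'
    (hg.measurable.mul (continuous_damp_right lv s).measurable).aestronglyMeasurable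
    (ae_of_all _ (hC s hs))

lemma IsHom.exists_integral_damp_le (hlv : ∀ k, 0 < lv k) (hg : IsHom lv d g) (hd : 0 < d) :
    ∃ C : ℝ, 0 ≤ C ∧ ∀ s, 0 < s → ∫ z, ‖g z * damp lv s z‖ ≤ C * s ^ (-decay lv d) := by
  obtain ⟨C, hC0, hC⟩ := hg.exists_damp_bound hlv hd
  obtain ⟨D, hD0, hD⟩ := exists_integral_exp_neg_sigma hlv
  refine ⟨C * (D * (1 / 2) ^ (-((homDim lv : ℝ) / (2 * totalWt lv)))), by positivity,
    fun s hs => ?_⟩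
  calc ∫ z, ‖g z * damp lv s z‖
      ≤ ∫ z, C * s ^ (-((d : ℝ) / (2 * totalWt lv))) * Real.exp (-(1 / 2 * s * sigma lv z)) :=
        integral_mono (hg.integrable_damp hlv hd hs).norm
          ((integrable_exp_neg_sigma hlv (by positivity : 0 < 1 / 2 * s)).const_mul _) (hC s hs)
    _ = _ := by
        rw [integral_const_mul, hD _ (by positivity), Real.mul_rpow (by norm_num) hs.le, decay,
          add_div, neg_add, Real.rpow_add hs]
        ring

lemma phase_integrable {h : EuclideanSpace ℝ (Fin n) → ℂ} (hh : Integrable h)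
    (x : EuclideanSpace ℝ (Fin n)) : Integrable fun z => phase x z * h z :=
  hh.bdd_mul (c := 1) (continuous_phase_right x).aestronglyMeasurable (ae_of_all _ fun z => by simp)

lemma norm_osc_le (lv : Fin n → ℕ) (g : EuclideanSpace ℝ (Fin n) → ℂ)
    (x : EuclideanSpace ℝ (Fin n)) (s : ℝ) : ‖osc lv g x s‖ ≤ ∫ z, ‖g z * damp lv s z‖ := by
  refine (norm_integral_le_integral_norm _).trans_eq ?_
  simp only [norm_mul, norm_phase, one_mul]

lemma hasLineDerivAt_phase (x z : EuclideanSpace ℝ (Fin n)) (k : Fin n) :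
    HasLineDerivAt ℝ (phase x) (Complex.I * x k * phase x z) z
      (EuclideanSpace.single k (1 : ℝ)) := by
  have h1 : (fun t : ℝ => phase x (z + t • EuclideanSpace.single k (1 : ℝ))) =
      fun t : ℝ => Complex.exp (Complex.I * x k * t) * phase x z := by
    funext t
    rw [phase, phase, ← Complex.exp_add]
    congr 1
    simp only [PiLp.add_apply, PiLp.smul_apply, PiLp.single_apply, smul_eq_mul, mul_ite,
      mul_one, mul_zero, mul_add, Finset.sum_add_distrib, Finset.sum_ite_eq', Finset.mem_univ,
      if_true]
    push_cast; ring
  unfold HasLineDerivAt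
  rw [h1]
  have h2 : HasDerivAt (fun t : ℝ => Complex.I * x k * (t : ℂ)) (Complex.I * x k) 0 := by
    simpa using (Complex.ofRealCLM.hasDerivAt (x := (0 : ℝ))).const_mul (Complex.I * x k)
  simpa using (h2.cexp).mul_const (phase x z)

/-- `∂_k σ`. -/
def sigmaDeriv (lv : Fin n → ℕ) (k : Fin n) (z : EuclideanSpace ℝ (Fin n)) : ℂ :=
  ((2 * lv k : ℕ) * z k ^ (2 * lv k - 1) : ℝ)

lemma isHom_sigmaDeriv (k : Fin n) :
    IsHom lv (2 * totalWt lv - wt lv k) (sigmaDeriv lv k) where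
  smooth := (Complex.ofRealCLM.contDiff.comp
    (contDiff_const.mul ((contDiff_coord k).pow _))).contDiffOn
  hom r hr z := by
    have h : 2 * totalWt lv - wt lv k = wt lv k * (2 * lv k - 1) := by
      rw [← wt_mul lv k, Nat.mul_sub, mul_one]; congr 1; ring
    simp only [sigmaDeriv, dil_apply, h, mul_pow, ← pow_mul]
    push_cast; ring

lemma hasLineDerivAt_damp (s : ℝ) (z : EuclideanSpace ℝ (Fin n)) (k : Fin n) :
    HasLineDerivAt ℝ (damp lv s) (-(s * sigmaDeriv lv k z * damp lv s z)) z
      (EuclideanSpace.single k (1 : ℝ)) := by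
  have h1 : HasDerivAt (fun t : ℝ => sigma lv (z + t • EuclideanSpace.single k (1 : ℝ)))
      ((2 * lv k : ℕ) * z k ^ (2 * lv k - 1)) 0 := by
    have : ∀ j ∈ Finset.univ, HasDerivAt
        (fun t : ℝ => (z + t • EuclideanSpace.single k (1 : ℝ)) j ^ (2 * lv j))
        (if j = k then ((2 * lv j : ℕ) : ℝ) * z j ^ (2 * lv j - 1) else 0) 0 := by
      intro j _
      by_cases hj : j = k
      · subst hj
        have := ((hasDerivAt_id (0 : ℝ)).const_add (z j)).pow (2 * lv j)
        simpa using! this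
      · simpa [hj] using hasDerivAt_const (0 : ℝ) (z j ^ (2 * lv j))
    have h := HasDerivAt.fun_sum this
    simpa [sigma] using h
  have h2 := ((h1.const_mul s).neg.exp).ofReal_comp
  unfold HasLineDerivAt
  convert! h2 using 1
  simp [damp, sigmaDeriv]
  ring

lemma hasLineDerivAt_mul {u v : EuclideanSpace ℝ (Fin n) → ℂ} {u' v' : ℂ}
    {z e : EuclideanSpace ℝ (Fin n)} (hu : HasLineDerivAt ℝ u u' z e)
    (hv : HasLineDerivAt ℝ v v' z e) :
    HasLineDerivAt ℝ (fun y => u y * v y) (u' * v z + u z * v') z e := by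
  have := HasDerivAt.mul hu hv
  simpa [HasLineDerivAt] using! this

/-- Integration by parts in the oscillatory integral. -/
lemma IsHom.coord_mul_osc (hlv : ∀ k, 0 < lv k) (hg : IsHom lv d g) {k : Fin n}
    (hd : 2 * wt lv k ≤ d) (x : EuclideanSpace ℝ (Fin n)) {s : ℝ} (hs : 0 < s) :
    Complex.I * x k * osc lv g x s =
      s * osc lv (fun z => sigmaDeriv lv k z * g z) x s -
      osc lv (fun z => lineDeriv ℝ g z (EuclideanSpace.single k (1 : ℝ))) x s := by
  have hw := wt_pos hlv k
  have hwW := wt_le_totalWt hlv k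
  have hd0 : 0 < d := by omega
  have hσg := (isHom_sigmaDeriv k).mul hg
  have hg' := hg.lineDeriv_single (k := k) (by omega)
  have i0 := hg.integrable_damp hlv hd0 hs
  have i1 := hσg.integrable_damp hlv (by omega) hs
  have i2 := hg'.integrable_damp hlv (by omega) hs
  have i3 : Integrable fun z => phase x z *
      (lineDeriv ℝ g z (EuclideanSpace.single k (1 : ℝ)) * damp lv s z +
        g z * -(s * sigmaDeriv lv k z * damp lv s z)) := by
    refine ((phase_integrable i2 x).sub ((phase_integrable i1 x).const_mul (s : ℂ))).congr
      (ae_of_all _ fun z => ?_)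
    simp only [Pi.sub_apply]; ring
  have ibp := integral_bilinear_hasLineDerivAt_right_eq_neg_left_of_integrable
    (μ := (volume : Measure (EuclideanSpace ℝ (Fin n)))) (B := ContinuousLinearMap.mul ℝ ℂ)
    (f := phase x) (f' := fun z => Complex.I * x k * phase x z)
    (g := fun z => g z * damp lv s z)
    (g' := fun z => lineDeriv ℝ g z (EuclideanSpace.single k (1 : ℝ)) * damp lv s z +
        g z * -(s * sigmaDeriv lv k z * damp lv s z))
    (v := EuclideanSpace.single k (1 : ℝ))
    (by simpa [mul_assoc] using ((phase_integrable i0 x).const_mul (Complex.I * x k)))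
    (by simpa using i3) (by simpa using phase_integrable i0 x)
    (fun z _ => hasLineDerivAt_phase x z k)
    (fun z _ => hasLineDerivAt_mul (hg.hasLineDerivAt hlv hd z) (hasLineDerivAt_damp s z k))
  simp only [ContinuousLinearMap.mul_apply'] at ibp
  have e1 : ∫ z, phase x z *
      (lineDeriv ℝ g z (EuclideanSpace.single k (1 : ℝ)) * damp lv s z +
        g z * -(s * sigmaDeriv lv k z * damp lv s z)) =
      osc lv (fun z => lineDeriv ℝ g z (EuclideanSpace.single k (1 : ℝ))) x s -
      s * osc lv (fun z => sigmaDeriv lv k z * g z) x s := by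
    rw [osc, osc, ← integral_const_mul, ← integral_sub (phase_integrable i2 x)
      ((phase_integrable i1 x).const_mul (s : ℂ))]
    congr 1; ext z; ring
  have e2 : ∫ z, Complex.I * x k * phase x z * (g z * damp lv s z) =
      Complex.I * x k * osc lv g x s := by
    rw [osc, ← integral_const_mul]; congr 1; ext z; ring
  rw [e1, e2] at ibp
  linear_combination ibp

/-- Induction on N by `IsHom.coord_mul_osc`, for all g at once since each step replaces g by `∂_k g`
and `g ∂_k σ`. A step lowers the degree by at most w_k and needs degree at least 2w_k, whence the
hypothesis on d. -/
lemma IsHom.exists_osc_bound (hlv : ∀ k, 0 < lv k) (k : Fin n) (N : ℕ) :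
    ∀ {d : ℕ} {g : EuclideanSpace ℝ (Fin n) → ℂ}, IsHom lv d g → (N + 1) * wt lv k ≤ d →
    ∃ C : ℝ, 0 ≤ C ∧ ∀ x s, 0 < s → |x k| ^ N * ‖osc lv g x s‖ ≤
      C * s ^ ((N : ℝ) * wt lv k / (2 * totalWt lv) - decay lv d) := by
  have hw := wt_pos hlv k
  have hwW := wt_le_totalWt hlv k
  have hW : (totalWt lv : ℝ) ≠ 0 := by exact_mod_cast (totalWt_pos hlv).ne'
  induction N with
  | zero =>
    intro d g hg hd
    obtain ⟨C, hC0, hC⟩ := hg.exists_integral_damp_le hlv (by omega)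
    refine ⟨C, hC0, fun x s hs => ?_⟩
    simpa using (norm_osc_le lv g x s).trans (hC s hs)
  | succ N ih =>
    intro d g hg hd
    have hd' : (N + 1) * wt lv k + wt lv k ≤ d := by rw [← Nat.succ_mul]; exact hd
    have hN : wt lv k ≤ (N + 1) * wt lv k := Nat.le_mul_of_pos_left _ (Nat.succ_pos N)
    have hd2 : 2 * wt lv k ≤ d := by omega
    obtain ⟨C₁, hC₁, h₁⟩ := ih (hg.lineDeriv_single (k := k) (by omega)) (by omega)
    obtain ⟨C₂, hC₂, h₂⟩ := ih ((isHom_sigmaDeriv k).mul hg) (by omega)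
    refine ⟨C₂ + C₁, by positivity, fun x s hs => ?_⟩
    have hx : |x k| * ‖osc lv g x s‖ ≤
        s * ‖osc lv (fun z => sigmaDeriv lv k z * g z) x s‖ +
        ‖osc lv (fun z => lineDeriv ℝ g z (EuclideanSpace.single k (1 : ℝ))) x s‖ := by
      have := congrArg norm (hg.coord_mul_osc hlv hd2 x hs)
      simp only [norm_mul, Complex.norm_I, one_mul, Complex.norm_real, Real.norm_eq_abs] at this
      rw [this]
      refine (norm_sub_le _ _).trans_eq ?_
      rw [norm_mul, Complex.norm_real, Real.norm_of_nonneg hs.le]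
    have a1 := h₁ x s hs
    have a2 := h₂ x s hs
    -- Both terms scale alike: the derivative loses degree w_k, while the degree gain 2W - w_k from
    -- `∂_k σ` is offset by the factor s.
    have E1 : (N : ℝ) * wt lv k / (2 * totalWt lv) - decay lv (d - wt lv k) =
        ((N + 1 : ℕ) : ℝ) * wt lv k / (2 * totalWt lv) - decay lv d := by
      rw [decay, decay, Nat.cast_sub (by omega)]; push_cast; field_simp; ring
    have E2 : 1 + ((N : ℝ) * wt lv k / (2 * totalWt lv) -
        decay lv (2 * totalWt lv - wt lv k + d)) =
        ((N + 1 : ℕ) : ℝ) * wt lv k / (2 * totalWt lv) - decay lv d := by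
      rw [decay, decay, Nat.cast_add, Nat.cast_sub (by omega)]; push_cast; field_simp; ring
    rw [E1] at a1
    calc |x k| ^ (N + 1) * ‖osc lv g x s‖ = |x k| ^ N * (|x k| * ‖osc lv g x s‖) := by ring
      _ ≤ |x k| ^ N * (s * ‖osc lv (fun z => sigmaDeriv lv k z * g z) x s‖ +
          ‖osc lv (fun z => lineDeriv ℝ g z (EuclideanSpace.single k (1 : ℝ))) x s‖) := by
          gcongr
      _ = s * (|x k| ^ N * ‖osc lv (fun z => sigmaDeriv lv k z * g z) x s‖) + |x k| ^ N *
          ‖osc lv (fun z => lineDeriv ℝ g z (EuclideanSpace.single k (1 : ℝ))) x s‖ := by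
          ring
      _ ≤ s * (C₂ * s ^ ((N : ℝ) * wt lv k / (2 * totalWt lv) -
          decay lv (2 * totalWt lv - wt lv k + d))) +
          C₁ * s ^ (((N + 1 : ℕ) : ℝ) * wt lv k / (2 * totalWt lv) - decay lv d) := by gcongr
      _ = (C₂ + C₁) * s ^ (((N + 1 : ℕ) : ℝ) * wt lv k / (2 * totalWt lv) - decay lv d) := by
          rw [← E2, Real.rpow_add hs, Real.rpow_one]; ring

end

/-! ### Time integrals of the kernel and convergence away from the origin. -/

section

open MeasureTheory Set Filter Topology

variable {n : ℕ}

lemma integrableOn_Ioi_of_rpow_bounds {E : Type*} [NormedAddCommGroup E] {h : ℝ → E}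
    (hm : AEStronglyMeasurable h (volume.restrict (Ioi 0))) {a b A B : ℝ} (ha : a < 1) (hb : 1 < b)
    (hA : ∀ t, 0 < t → ‖h t‖ ≤ A * t ^ (-a)) (hB : ∀ t, 0 < t → ‖h t‖ ≤ B * t ^ (-b)) :
    IntegrableOn h (Ioi 0) := by
  rw [← Ioc_union_Ioi_eq_Ioi zero_le_one]
  refine IntegrableOn.union ?_ ?_
  · have h1 : IntegrableOn (fun t : ℝ => t ^ (-a)) (Ioc 0 1) := by
      have := intervalIntegral.intervalIntegrable_rpow' (a := 0) (b := 1) (r := -a) (by linarith)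
      rwa [intervalIntegrable_iff_integrableOn_Ioc_of_le zero_le_one] at this
    refine (h1.const_mul A).mono' (hm.mono_measure (Measure.restrict_mono Ioc_subset_Ioi_self le_rfl))
      ?_
    exact (ae_restrict_mem measurableSet_Ioc).mono fun t ht => hA t ht.1
  · have h1 : IntegrableOn (fun t : ℝ => t ^ (-b)) (Ioi 1) :=
      integrableOn_Ioi_rpow_of_lt (by linarith) one_pos
    refine (h1.const_mul B).mono'
      (hm.mono_measure (Measure.restrict_mono (Ioi_subset_Ioi zero_le_one) le_rfl)) ?_
    exact (ae_restrict_mem measurableSet_Ioi).mono fun t ht => hB t (one_pos.trans ht)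

lemma integrableOn_add_rpow {η t : ℝ} (hη : 0 < η) (ht : 0 < t) :
    IntegrableOn (fun r : ℝ => (t + r) ^ (-1 - η)) (Ioi 0) := by
  simpa only [add_comm t] using integrableOn_add_rpow_Ioi_of_lt (a := -1 - η) (c := 0) (m := t)
    (by linarith) (by linarith)

lemma integral_add_rpow {η t : ℝ} (hη : 0 < η) (ht : 0 < t) :
    ∫ r in Ioi (0 : ℝ), (t + r) ^ (-1 - η) = η⁻¹ * t ^ (-η) := by
  have h := (measurePreserving_add_left volume t).setIntegral_preimage_emb
    (measurableEmbedding_addLeft t) (fun s : ℝ => s ^ (-1 - η)) (Ioi t)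
  have h2 : (fun x => t + x) ⁻¹' Ioi t = Ioi (0 : ℝ) := by ext x; simp
  rw [h2] at h
  rw [h, integral_Ioi_rpow_of_lt (by linarith) ht]
  rw [show -1 - η + 1 = -η by ring]
  field_simp

/-- `ℓ` is smooth away from the origin and homogeneous of degree `-totalWt lv`. -/
structure IsInvHom (lv : Fin n → ℕ) (ℓ : EuclideanSpace ℝ (Fin n) → ℂ) : Prop where
  smooth : ContDiffOn ℝ ∞ ℓ {0}ᶜ
  hom : ∀ r : ℝ, 0 < r → ∀ z, z ≠ 0 → (r : ℂ) ^ totalWt lv * ℓ (dil lv r z) = ℓ z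

/-- The function `σ^q ℓ`. -/
def sigmaPow (lv : Fin n → ℕ) (ℓ : EuclideanSpace ℝ (Fin n) → ℂ) (q : ℕ)
    (z : EuclideanSpace ℝ (Fin n)) : ℂ := (sigma lv z : ℂ) ^ q * ℓ z

variable {lv : Fin n → ℕ} {ℓ : EuclideanSpace ℝ (Fin n) → ℂ}

lemma IsInvHom.measurable (hℓ : IsInvHom lv ℓ) : Measurable ℓ :=
  measurable_of_continuousOn_compl_singleton 0 hℓ.smooth.continuousOn

/-- At least one factor σ makes the degree positive and makes the product vanish at the origin,
whatever value ℓ has there. -/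
lemma IsInvHom.isHom (hlv : ∀ k, 0 < lv k) (hℓ : IsInvHom lv ℓ) (q : ℕ) :
    IsHom lv ((2 * q + 1) * totalWt lv) (sigmaPow lv ℓ (q + 1)) where
  smooth := ((IsHom.of_sigma lv).smooth.pow _).mul hℓ.smooth
  hom r hr z := by
    rcases eq_or_ne z 0 with rfl | hz
    · have h0 : dil lv r (0 : EuclideanSpace ℝ (Fin n)) = 0 := by ext k; simp
      simp [sigmaPow, h0, sigma_zero hlv]
    · simp only [sigmaPow]
      rw [sigma_dil, ← hℓ.hom r hr z hz]
      push_cast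
      ring

lemma deg_pos (hlv : ∀ k, 0 < lv k) (q : ℕ) : 0 < (2 * q + 1) * totalWt lv :=
  Nat.mul_pos (Nat.succ_pos _) (totalWt_pos hlv)

lemma decay_deg (hlv : ∀ k, 0 < lv k) (q : ℕ) :
    decay lv ((2 * q + 1) * totalWt lv) = q + decay lv (totalWt lv) := by
  have hW : (totalWt lv : ℝ) ≠ 0 := by exact_mod_cast (totalWt_pos hlv).ne'
  simp only [decay]; push_cast; field_simp; ring

lemma one_lt_decay (hlv : ∀ k, 0 < lv k) (hdim : totalWt lv < homDim lv) :
    1 < decay lv (totalWt lv) := by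
  have hW : (0 : ℝ) < totalWt lv := by exact_mod_cast totalWt_pos hlv
  have : (totalWt lv : ℝ) < homDim lv := by exact_mod_cast hdim
  rw [decay, lt_div_iff₀ (by positivity)]; linarith

lemma measurable_phase_comp {α : Type*} [MeasurableSpace α] {u v : α → EuclideanSpace ℝ (Fin n)}
    (hu : Measurable u) (hv : Measurable v) : Measurable fun a => phase (u a) (v a) :=
  Measurable.comp (g := fun p : EuclideanSpace ℝ (Fin n) × EuclideanSpace ℝ (Fin n) =>
    phase p.1 p.2) (f := fun a => (u a, v a)) continuous_phase.measurable (hu.prodMk hv)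

lemma measurable_damp_comp (lv : Fin n → ℕ) {α : Type*} [MeasurableSpace α] {u : α → ℝ}
    {v : α → EuclideanSpace ℝ (Fin n)}
    (hu : Measurable u) (hv : Measurable v) : Measurable fun a => damp lv (u a) (v a) :=
  Measurable.comp (g := fun p : ℝ × EuclideanSpace ℝ (Fin n) => damp lv p.1 p.2)
    (f := fun a => (u a, v a)) (continuous_damp lv).measurable (hu.prodMk hv)

lemma IsHom.measurable_osc_integrand {d : ℕ} {g : EuclideanSpace ℝ (Fin n) → ℂ}
    (hg : IsHom lv d g) {α : Type*} [MeasurableSpace α] {u v : α → EuclideanSpace ℝ (Fin n)}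
    {s : α → ℝ} (hu : Measurable u) (hs : Measurable s) (hv : Measurable v) :
    Measurable fun a => phase (u a) (v a) * (g (v a) * damp lv (s a) (v a)) :=
  (measurable_phase_comp hu hv).mul ((hg.measurable.comp hv).mul (measurable_damp_comp lv hs hv))

lemma IsHom.measurable_osc {d : ℕ} {g : EuclideanSpace ℝ (Fin n) → ℂ} (hg : IsHom lv d g)
    {α : Type*} [MeasurableSpace α] {u : α → EuclideanSpace ℝ (Fin n)}
    {s : α → ℝ} (hu : Measurable u) (hs : Measurable s) :
    Measurable fun a => osc lv g (u a) (s a) := by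
  have h := hg.measurable_osc_integrand (α := α × EuclideanSpace ℝ (Fin n))
    (hu.comp measurable_fst) (hs.comp measurable_fst) measurable_snd
  exact (h.stronglyMeasurable.integral_prod_right
    (ν := (volume : Measure (EuclideanSpace ℝ (Fin n))))).measurable

/-- Since r ≤ t + r, the weight r^p uses up the extra decay that comes with p more powers of σ. -/
lemma rpow_combine {p : ℕ} {t r e : ℝ} (ht : 0 < t) (hr : 0 < r) :
    r ^ p * (t + r) ^ (-(p + e)) ≤ (t + r) ^ (-e) := by
  have hs : 0 < t + r := by linarith
  calc r ^ p * (t + r) ^ (-(p + e)) ≤ (t + r) ^ p * (t + r) ^ (-(p + e)) := by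
        have : 0 ≤ (t + r) ^ (-(p + e)) := Real.rpow_nonneg hs.le _
        gcongr; linarith
    _ = (t + r) ^ (-e) := by
        rw [← Real.rpow_natCast (t + r), ← Real.rpow_add hs]; ring_nf

/-- Raising the power of `σ`: the kernel is a fractional integral in time of smoother kernels. -/
lemma IsInvHom.osc_eq_integral (hlv : ∀ k, 0 < lv k) (hℓ : IsInvHom lv ℓ) (p : ℕ)
    (x : EuclideanSpace ℝ (Fin n)) {t : ℝ} (ht : 0 < t) :
    osc lv (sigmaPow lv ℓ 1) x t = ((p.factorial : ℝ) : ℂ)⁻¹ *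
      ∫ r in Ioi (0 : ℝ), ((r ^ p : ℝ) : ℂ) * osc lv (sigmaPow lv ℓ (p + 2)) x (t + r) := by
  have hh := hℓ.isHom hlv (p + 1)
  set g := sigmaPow lv ℓ (p + 2) with hg
  obtain ⟨C, hC0, hC⟩ := hh.exists_integral_damp_le hlv (deg_pos hlv _)
  have hdec0 : 0 < decay lv (totalWt lv) := by
    have hW : (0 : ℝ) < totalWt lv := by exact_mod_cast totalWt_pos hlv
    unfold decay; positivity
  have hmeas : Measurable fun q : ℝ × EuclideanSpace ℝ (Fin n) =>
      ((q.1 ^ p : ℝ) : ℂ) * (phase x q.2 * (g q.2 * damp lv (t + q.1) q.2)) := by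
    have h1 : Measurable fun q : ℝ × EuclideanSpace ℝ (Fin n) =>
        phase x q.2 * (g q.2 * damp lv (t + q.1) q.2) :=
      hh.measurable_osc_integrand measurable_const (measurable_const.add measurable_fst)
        measurable_snd
    exact (Complex.measurable_ofReal.comp (measurable_fst.pow_const p)).mul h1
  have hint : Integrable (fun q : ℝ × EuclideanSpace ℝ (Fin n) =>
      ((q.1 ^ p : ℝ) : ℂ) * (phase x q.2 * (g q.2 * damp lv (t + q.1) q.2)))
      ((volume.restrict (Ioi 0)).prod volume) := by
    rw [integrable_prod_iff hmeas.aestronglyMeasurable]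
    constructor
    · refine (ae_restrict_mem measurableSet_Ioi).mono fun r hr => ?_
      have hr0 : (0 : ℝ) < r := hr
      have hi : Integrable fun z => g z * damp lv (t + r) z :=
        hh.integrable_damp hlv (deg_pos hlv _) (by linarith)
      exact (phase_integrable hi x).const_mul ((r ^ p : ℝ) : ℂ)
    · refine ((integrableOn_add_rpow hdec0 ht).const_mul C).mono'
        (hmeas.norm.stronglyMeasurable.integral_prod_right).aestronglyMeasurable ?_
      refine (ae_restrict_mem measurableSet_Ioi).mono fun r hr => ?_
      have hr0 : (0 : ℝ) < r := hr
      rw [Real.norm_of_nonneg (integral_nonneg fun _ => norm_nonneg _)]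
      simp only [norm_mul (Complex.ofReal _), norm_mul (phase _ _), norm_phase, one_mul,
        Complex.norm_real]
      rw [integral_const_mul, Real.norm_of_nonneg (by positivity)]
      calc r ^ p * ∫ z, ‖g z * damp lv (t + r) z‖
          ≤ r ^ p * (C * (t + r) ^ (-decay lv ((2 * (p + 1) + 1) * totalWt lv))) := by
            gcongr; exact hC _ (by linarith)
        _ = C * (r ^ p * (t + r) ^ (-(p + (1 + decay lv (totalWt lv))))) := by
            rw [decay_deg hlv]; push_cast; ring_nf
        _ ≤ C * (t + r) ^ (-(1 + decay lv (totalWt lv))) := by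
            gcongr; exact rpow_combine ht hr0
        _ = _ := by ring_nf
  have hswap := integral_integral_swap (f := fun (r : ℝ) (z : EuclideanSpace ℝ (Fin n)) =>
      ((r ^ p : ℝ) : ℂ) * (phase x z * (g z * damp lv (t + r) z))) hint
  have e1 : ∫ r in Ioi (0 : ℝ), ((r ^ p : ℝ) : ℂ) * osc lv g x (t + r) =
      ∫ r in Ioi (0 : ℝ), ∫ z, ((r ^ p : ℝ) : ℂ) * (phase x z * (g z * damp lv (t + r) z)) := by
    simp only [osc, integral_const_mul]
  rw [e1, hswap, ← integral_const_mul, osc]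
  congr 1; ext z
  have hfac : ((p.factorial : ℝ) : ℂ) ≠ 0 := by exact_mod_cast p.factorial_ne_zero
  rcases eq_or_ne z 0 with rfl | hz
  · simp [hg, sigmaPow, sigma_zero hlv]
  have hσ := sigma_pos lv hz
  have e2 : ∀ r : ℝ, ((r ^ p : ℝ) : ℂ) * (phase x z * (g z * damp lv (t + r) z)) =
      (phase x z * g z * damp lv t z) * ((r ^ p * Real.exp (-(sigma lv z * r)) : ℝ) : ℂ) := by
    intro r
    have : damp lv (t + r) z = damp lv t z * ((Real.exp (-(sigma lv z * r)) : ℝ) : ℂ) := by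
      rw [damp, damp, ← Complex.ofReal_mul, ← Real.exp_add]; ring_nf
    rw [this]; push_cast; ring
  -- The Gamma integral trades the p + 1 surplus powers of σ for p!.
  have e3 : ∫ r in Ioi (0 : ℝ), r ^ p * Real.exp (-(sigma lv z * r)) =
      p.factorial / sigma lv z ^ (p + 1) := by
    have h := Real.integral_rpow_mul_exp_neg_mul_Ioi (a := (p : ℝ) + 1) (by positivity) hσ
    simp only [add_sub_cancel_right, Real.rpow_natCast] at h
    rw [h, Real.Gamma_nat_eq_factorial, ← Nat.cast_succ, Real.rpow_natCast, one_div, inv_pow]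
    field_simp
  simp_rw [e2]
  rw [integral_const_mul, integral_complex_ofReal, e3]
  have hσ' : (sigma lv z : ℂ) ≠ 0 := by exact_mod_cast hσ.ne'
  push_cast at hfac ⊢
  rw [hg]
  simp only [sigmaPow]
  field_simp
  ring

lemma IsInvHom.norm_osc_le_integral (hlv : ∀ k, 0 < lv k) (hℓ : IsInvHom lv ℓ) (p : ℕ)
    (x : EuclideanSpace ℝ (Fin n)) {t : ℝ} (ht : 0 < t) :
    ‖osc lv (sigmaPow lv ℓ 1) x t‖ ≤
      ∫ r in Ioi (0 : ℝ), ‖((r ^ p : ℝ) : ℂ) * osc lv (sigmaPow lv ℓ (p + 2)) x (t + r)‖ := by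
  rw [hℓ.osc_eq_integral hlv p x ht, norm_mul]
  have h1 : ‖((p.factorial : ℝ) : ℂ)⁻¹‖ ≤ 1 := by
    rw [norm_inv, Complex.norm_real, Real.norm_of_nonneg (by positivity)]
    exact inv_le_one_of_one_le₀ (by exact_mod_cast p.factorial_pos)
  calc _ ≤ 1 * _ := mul_le_mul_of_nonneg_right h1 (norm_nonneg _)
    _ ≤ _ := by rw [one_mul]; exact norm_integral_le_integral_norm _

lemma IsInvHom.exists_osc_one_bound (hlv : ∀ k, 0 < lv k) (hℓ : IsInvHom lv ℓ) :
    ∃ C : ℝ, 0 ≤ C ∧ ∀ x t, 0 < t → ‖osc lv (sigmaPow lv ℓ 1) x t‖ ≤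
      C * t ^ (-decay lv (totalWt lv)) := by
  obtain ⟨C, hC0, hC⟩ := (hℓ.isHom hlv 0).exists_integral_damp_le hlv (deg_pos hlv _)
  refine ⟨C, hC0, fun x t ht => (norm_osc_le _ _ _ _).trans ?_⟩
  simpa using hC t ht

/-- The time integral that defines the fundamental solution converges away from the origin. -/
lemma IsInvHom.integrableOn_osc (hlv : ∀ k, 0 < lv k) (hdim : totalWt lv < homDim lv)
    (hℓ : IsInvHom lv ℓ) {x : EuclideanSpace ℝ (Fin n)} (hx : x ≠ 0) :
    IntegrableOn (fun t => osc lv (sigmaPow lv ℓ 1) x t) (Ioi 0) := by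
  obtain ⟨k, hk⟩ : ∃ k, x k ≠ 0 := by
    contrapose! hx
    ext k; simp [hx k]
  have hw := wt_pos hlv k
  have hwW := wt_le_totalWt hlv k
  have hW0 := totalWt_pos hlv
  have hW : (0 : ℝ) < totalWt lv := by exact_mod_cast hW0
  -- The open interval from Q - W to Q + W has length 2W > w_k, so it contains a multiple of w_k.
  -- The two inequalities say η < 1 and η > 0 for the exponent η below: integrability in t near 0,
  -- and convergence of the integral in r.
  obtain ⟨N, hN1, hN2⟩ : ∃ N : ℕ, homDim lv - totalWt lv < N * wt lv k ∧
      N * wt lv k < homDim lv + totalWt lv := by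
    refine ⟨(homDim lv - totalWt lv) / wt lv k + 1, ?_, ?_⟩
    · have := Nat.lt_div_mul_add (a := homDim lv - totalWt lv) hw
      rw [add_mul, one_mul]; exact this
    · have := Nat.div_mul_le_self (homDim lv - totalWt lv) (wt lv k)
      rw [add_mul, one_mul]; omega
  have hN1' : (homDim lv : ℝ) < N * wt lv k + totalWt lv := by
    have : homDim lv < N * wt lv k + totalWt lv := by omega
    exact_mod_cast this
  have hN2' : (N : ℝ) * wt lv k < homDim lv + totalWt lv := by exact_mod_cast hN2
  set η : ℝ := decay lv (totalWt lv) - N * wt lv k / (2 * totalWt lv) with hη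
  have hη' : η = (totalWt lv + homDim lv - N * wt lv k) / (2 * totalWt lv) := by
    rw [hη, decay, ← sub_div]
  have hη0 : 0 < η := by rw [hη']; apply div_pos <;> linarith
  have hη1 : η < 1 := by rw [hη', div_lt_one (by positivity)]; linarith
  obtain ⟨B, hB0, hB⟩ := hℓ.exists_osc_one_bound hlv
  -- With N + 2 powers of σ the degree is (2N + 3)W, enough for N integrations by parts.
  obtain ⟨C, hC0, hC⟩ := IsHom.exists_osc_bound hlv k N (hℓ.isHom hlv (N + 1)) (by
    calc (N + 1) * wt lv k ≤ (2 * (N + 1) + 1) * totalWt lv := by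
          exact Nat.mul_le_mul (by omega) hwW)
  have hxk : 0 < |x k| ^ N := pow_pos (abs_pos.2 hk) N
  refine integrableOn_Ioi_of_rpow_bounds (a := η) (b := decay lv (totalWt lv))
    (A := C / |x k| ^ N * η⁻¹) (B := B) ?_ hη1 (one_lt_decay hlv hdim) ?_ (hB x)
  · exact ((hℓ.isHom hlv 0).measurable_osc measurable_const measurable_id).aestronglyMeasurable
  · intro t ht
    calc ‖osc lv (sigmaPow lv ℓ 1) x t‖
        ≤ ∫ r in Ioi (0 : ℝ), ‖((r ^ N : ℝ) : ℂ) * osc lv (sigmaPow lv ℓ (N + 2)) x (t + r)‖ :=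
          hℓ.norm_osc_le_integral hlv N x ht
      _ ≤ ∫ r in Ioi (0 : ℝ), C / |x k| ^ N * (t + r) ^ (-1 - η) := by
          refine integral_mono_of_nonneg (ae_of_all _ fun _ => norm_nonneg _)
            ((integrableOn_add_rpow hη0 ht).const_mul _) ?_
          refine (ae_restrict_mem measurableSet_Ioi).mono fun r hr => ?_
          have hr0 : (0 : ℝ) < r := hr
          have h1 := hC x (t + r) (by linarith)
          rw [mul_comm, ← le_div_iff₀ hxk] at h1
          simp only [norm_mul, Complex.norm_real]
          rw [Real.norm_of_nonneg (by positivity)]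
          calc r ^ N * ‖osc lv (sigmaPow lv ℓ (N + 2)) x (t + r)‖
              ≤ r ^ N * (C * (t + r) ^ ((N : ℝ) * wt lv k / (2 * totalWt lv) -
                  decay lv ((2 * (N + 1) + 1) * totalWt lv)) / |x k| ^ N) := by gcongr
            _ = C / |x k| ^ N * (r ^ N * (t + r) ^ (-(N + (1 + η)))) := by
                have : (N : ℝ) * wt lv k / (2 * totalWt lv) -
                    decay lv ((2 * (N + 1) + 1) * totalWt lv) = -(N + (1 + η)) := by
                  rw [decay_deg hlv, hη]; push_cast; ring
                rw [this]; ring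
            _ ≤ C / |x k| ^ N * (t + r) ^ (-(1 + η)) := by
                gcongr; exact rpow_combine ht hr0
            _ = C / |x k| ^ N * (t + r) ^ (-1 - η) := by rw [neg_add']
      _ = C / |x k| ^ N * η⁻¹ * t ^ (-η) := by
          rw [integral_const_mul, integral_add_rpow hη0 ht]; ring

/-! ### The L¹ bound of the kernel at a fixed time. -/

/-- Bounds in single coordinates combine into a product bound: multiply the n estimates for v(1 +
a_i²)^n and take the n-th root. -/
lemma mul_prod_one_add_sq_le {ι : Type*} [Fintype ι] [Nonempty ι] {v C : ℝ} {a : ι → ℝ}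
    (hv : 0 ≤ v) (hC : v ≤ C) (ha : ∀ i, a i ^ (2 * Fintype.card ι) * v ≤ C) :
    v * ∏ i, (1 + a i ^ 2) ≤ 2 ^ Fintype.card ι * C := by
  set n := Fintype.card ι with hn
  have hn0 : n ≠ 0 := Fintype.card_ne_zero
  have hC0 : 0 ≤ C := hv.trans hC
  have h1 : ∀ i, v * (1 + a i ^ 2) ^ n ≤ 2 ^ n * C := by
    intro i
    rcases le_total (a i ^ 2) 1 with h | h
    · calc v * (1 + a i ^ 2) ^ n ≤ C * 2 ^ n := by
            gcongr; linarith
        _ = _ := mul_comm _ _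
    · calc v * (1 + a i ^ 2) ^ n ≤ v * (2 * a i ^ 2) ^ n := by
            gcongr; linarith
        _ = 2 ^ n * (a i ^ (2 * n) * v) := by rw [mul_pow, pow_mul]; ring
        _ ≤ 2 ^ n * C := by gcongr; exact ha i
  have h2 : (v * ∏ i, (1 + a i ^ 2)) ^ n ≤ (2 ^ n * C) ^ n := by
    calc (v * ∏ i, (1 + a i ^ 2)) ^ n = ∏ i, v * (1 + a i ^ 2) ^ n := by
          rw [Finset.prod_mul_distrib, Finset.prod_const, Finset.card_univ, Finset.prod_pow,
            mul_pow]
      _ ≤ ∏ _i : ι, 2 ^ n * C := Finset.prod_le_prod (fun i _ => by positivity) fun i _ => h1 i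
      _ = _ := by rw [Finset.prod_const, Finset.card_univ]
  exact le_of_pow_le_pow_left₀ hn0 (by positivity) h2

/-- The 2n-th power of each coordinate is needed to obtain one factor (1 + a_k²)⁻¹ per coordinate
after the n-th root; n + 2 powers of σ give degree (2n + 3)W, which allows 2n integrations by parts.
-/
lemma IsInvHom.exists_osc_prod_bound (hlv : ∀ k, 0 < lv k) (hn : 0 < n) (hℓ : IsInvHom lv ℓ) :
    ∃ C : ℝ, 0 ≤ C ∧ ∀ x s, 0 < s → ‖osc lv (sigmaPow lv ℓ (n + 2)) x s‖ ≤
      C * s ^ (-(n + (1 + decay lv (totalWt lv)))) *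
        ∏ k, (1 + ((scl lv s k)⁻¹ * x k) ^ 2)⁻¹ := by
  have : Nonempty (Fin n) := ⟨⟨0, hn⟩⟩
  have hW0 := totalWt_pos hlv
  have hh := hℓ.isHom hlv (n + 1)
  have hdeg : decay lv ((2 * (n + 1) + 1) * totalWt lv) = n + (1 + decay lv (totalWt lv)) := by
    rw [decay_deg hlv]; push_cast; ring
  obtain ⟨C, hC0, hC⟩ := hh.exists_integral_damp_le hlv (deg_pos hlv _)
  choose D hD0 hD using fun k => IsHom.exists_osc_bound hlv k (2 * n) hh (by
    have := wt_le_totalWt hlv k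
    calc (2 * n + 1) * wt lv k ≤ (2 * (n + 1) + 1) * totalWt lv := by gcongr; omega)
  rw [hdeg] at hC hD
  set e : ℝ := n + (1 + decay lv (totalWt lv)) with he
  have hCD : 0 ≤ C + ∑ k, D k := add_nonneg hC0 (Finset.sum_nonneg fun k _ => hD0 k)
  refine ⟨2 ^ n * (C + ∑ k, D k), by positivity, fun x s hs => ?_⟩
  have hse : 0 < s ^ (-e) := Real.rpow_pos_of_pos hs _
  have key := mul_prod_one_add_sq_le (ι := Fin n)
    (v := ‖osc lv (sigmaPow lv ℓ (n + 2)) x s‖) (C := (C + ∑ k, D k) * s ^ (-e))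
    (a := fun k => (scl lv s k)⁻¹ * x k) (norm_nonneg _) ?_ ?_
  · rw [Fintype.card_fin, ← le_div_iff₀ (Finset.prod_pos fun k _ => by positivity)] at key
    refine key.trans_eq ?_
    rw [Finset.prod_inv_distrib, div_eq_mul_inv]; ring
  · refine (norm_osc_le lv _ x s).trans ((hC s hs).trans ?_)
    gcongr
    exact le_add_of_nonneg_right (Finset.sum_nonneg fun k _ => hD0 k)
  · intro k
    rw [Fintype.card_fin]
    have h1 := hD k x s hs
    have h2 : |x k| ^ (2 * n) = x k ^ (2 * n) := by rw [pow_mul, sq_abs, ← pow_mul]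
    have hscl := scl_pos lv hs k
    have h3 : s ^ (((2 * n : ℕ) : ℝ) * wt lv k / (2 * totalWt lv) - e) =
        scl lv s k ^ (2 * n) * s ^ (-e) := by
      rw [scl, ← Real.rpow_mul_natCast hs.le, ← Real.rpow_add hs]; congr 1; ring
    rw [h2, h3] at h1
    calc ((scl lv s k)⁻¹ * x k) ^ (2 * n) * ‖osc lv (sigmaPow lv ℓ (n + 2)) x s‖
        = (scl lv s k ^ (2 * n))⁻¹ * (x k ^ (2 * n) * ‖osc lv (sigmaPow lv ℓ (n + 2)) x s‖) := by
          rw [mul_pow, inv_pow]; ring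
      _ ≤ (scl lv s k ^ (2 * n))⁻¹ * (D k * (scl lv s k ^ (2 * n) * s ^ (-e))) := by gcongr
      _ = D k * s ^ (-e) := by field_simp
      _ ≤ (C + ∑ k, D k) * s ^ (-e) := by
          gcongr
          have := Finset.single_le_sum (f := D) (fun k _ => hD0 k) (Finset.mem_univ k)
          linarith

/-- The `L¹` norm of the kernel at time `t` is `O(t^{-1/2})`. -/
lemma IsInvHom.exists_integral_osc_le (hlv : ∀ k, 0 < lv k) (hn : 0 < n) (hℓ : IsInvHom lv ℓ) :
    ∃ C : ℝ, 0 ≤ C ∧ ∀ t, 0 < t → Integrable (fun x => osc lv (sigmaPow lv ℓ 1) x t) ∧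
      ∫ x, ‖osc lv (sigmaPow lv ℓ 1) x t‖ ≤ C * t ^ (-(1 / 2) : ℝ) := by
  obtain ⟨C, hC0, hC⟩ := hℓ.exists_osc_prod_bound hlv hn
  have hW : (0 : ℝ) < totalWt lv := by exact_mod_cast totalWt_pos hlv
  have hh := hℓ.isHom hlv (n + 1)
  set g := sigmaPow lv ℓ (n + 2) with hg
  set K : ℝ := ∏ _k : Fin n, ∫ x : ℝ, (1 + x ^ 2)⁻¹ with hK
  have hK0 : 0 ≤ K := Finset.prod_nonneg fun _ _ => integral_nonneg fun x => by positivity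
  have hprod : ∀ s : ℝ, 0 < s →
      Integrable (fun x : EuclideanSpace ℝ (Fin n) => ∏ k, (1 + ((scl lv s k)⁻¹ * x k) ^ 2)⁻¹) ∧
      ∫ x : EuclideanSpace ℝ (Fin n), ∏ k, (1 + ((scl lv s k)⁻¹ * x k) ^ 2)⁻¹ =
        s ^ ((homDim lv : ℝ) / (2 * totalWt lv)) * K := by
    intro s hs
    have := integrable_prod_scale (fun (_ : Fin n) (x : ℝ) => (1 + x ^ 2)⁻¹)
      (fun _ => integrable_inv_one_add_sq) (c := fun k => (scl lv s k)⁻¹)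
      (fun k => inv_pos.2 (scl_pos lv hs k))
    refine ⟨this.1, this.2.trans ?_⟩
    simp only [inv_inv, prod_scl lv hs, hK]
  have hosc : ∀ s : ℝ, 0 < s → Integrable (fun x => osc lv g x s) ∧
      ∫ x, ‖osc lv g x s‖ ≤ C * K * s ^ (-(n + (1 + 1 / 2) : ℝ)) := by
    intro s hs
    have hm : Measurable fun x => osc lv g x s :=
      hh.measurable_osc measurable_id measurable_const
    have hi : Integrable fun x : EuclideanSpace ℝ (Fin n) =>
        C * s ^ (-(n + (1 + decay lv (totalWt lv)))) *
        ∏ k, (1 + ((scl lv s k)⁻¹ * x k) ^ 2)⁻¹ := (hprod s hs).1.const_mul _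
    refine ⟨hi.mono' hm.aestronglyMeasurable (ae_of_all _ fun x => hC x s hs), ?_⟩
    refine (integral_mono_of_nonneg (ae_of_all _ fun _ => norm_nonneg _) hi
      (ae_of_all _ fun x => hC x s hs)).trans_eq ?_
    rw [integral_const_mul, (hprod s hs).2]
    -- The volume factor s^{Q/(2W)} cancels the Q-part of the decay and leaves W/(2W) = 1/2.
    have : (-(n + (1 + 1 / 2) : ℝ)) = -(n + (1 + decay lv (totalWt lv))) +
        (homDim lv : ℝ) / (2 * totalWt lv) := by
      rw [decay]; field_simp; ring
    rw [this, Real.rpow_add hs]; ring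
  -- The factor 2 is η⁻¹ for η = 1/2 in `integral_add_rpow`.
  refine ⟨C * K * 2, by positivity, fun t ht => ?_⟩
  have hmeas : Measurable fun q : ℝ × EuclideanSpace ℝ (Fin n) =>
      ((q.1 ^ n : ℝ) : ℂ) * osc lv g q.2 (t + q.1) := by
    have h1 : Measurable fun q : ℝ × EuclideanSpace ℝ (Fin n) => osc lv g q.2 (t + q.1) :=
      hh.measurable_osc measurable_snd (measurable_const.add measurable_fst)
    exact (Complex.measurable_ofReal.comp (measurable_fst.pow_const n)).mul h1
  have hbd : ∀ r ∈ Ioi (0 : ℝ), ∫ x, ‖((r ^ n : ℝ) : ℂ) * osc lv g x (t + r)‖ ≤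
      C * K * (t + r) ^ (-1 - 1 / 2 : ℝ) := by
    intro r hr
    have hr0 : (0 : ℝ) < r := hr
    simp only [norm_mul, Complex.norm_real]
    rw [integral_const_mul, Real.norm_of_nonneg (by positivity)]
    calc r ^ n * ∫ x, ‖osc lv g x (t + r)‖
        ≤ r ^ n * (C * K * (t + r) ^ (-(n + (1 + 1 / 2) : ℝ))) := by
          gcongr; exact (hosc _ (by linarith)).2
      _ = C * K * (r ^ n * (t + r) ^ (-(n + (1 + 1 / 2) : ℝ))) := by ring
      _ ≤ C * K * (t + r) ^ (-(1 + 1 / 2) : ℝ) := by gcongr; exact rpow_combine ht hr0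
      _ = _ := by rw [neg_add']
  have hmaj := (integrableOn_add_rpow (η := 1 / 2) (by norm_num) ht).const_mul (C * K)
  have hint : Integrable (fun q : ℝ × EuclideanSpace ℝ (Fin n) =>
      ((q.1 ^ n : ℝ) : ℂ) * osc lv g q.2 (t + q.1))
      ((volume.restrict (Ioi 0)).prod volume) := by
    rw [integrable_prod_iff hmeas.aestronglyMeasurable]
    constructor
    · refine (ae_restrict_mem measurableSet_Ioi).mono fun r hr => ?_
      have hr0 : (0 : ℝ) < r := hr
      exact (hosc (t + r) (by linarith)).1.const_mul ((r ^ n : ℝ) : ℂ)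
    · refine hmaj.mono' (hmeas.norm.stronglyMeasurable.integral_prod_right).aestronglyMeasurable ?_
      refine (ae_restrict_mem measurableSet_Ioi).mono fun r hr => ?_
      rw [Real.norm_of_nonneg (integral_nonneg fun _ => norm_nonneg _)]
      exact hbd r hr
  constructor
  · simp_rw [hℓ.osc_eq_integral hlv n _ ht]
    exact hint.integral_prod_right.const_mul _
  · calc ∫ x, ‖osc lv (sigmaPow lv ℓ 1) x t‖
        ≤ ∫ x, ∫ r in Ioi (0 : ℝ), ‖((r ^ n : ℝ) : ℂ) * osc lv g x (t + r)‖ :=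
          integral_mono_of_nonneg (ae_of_all _ fun _ => norm_nonneg _)
            hint.norm.integral_prod_right
            (ae_of_all _ fun x => hℓ.norm_osc_le_integral hlv n x ht)
      _ = ∫ r in Ioi (0 : ℝ), ∫ x, ‖((r ^ n : ℝ) : ℂ) * osc lv g x (t + r)‖ :=
          (integral_integral_swap (f := fun (r : ℝ) (x : EuclideanSpace ℝ (Fin n)) =>
            ‖((r ^ n : ℝ) : ℂ) * osc lv g x (t + r)‖) hint.norm).symm
      _ ≤ ∫ r in Ioi (0 : ℝ), C * K * (t + r) ^ (-1 - 1 / 2 : ℝ) :=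
          integral_mono_of_nonneg (ae_of_all _ fun _ => integral_nonneg fun _ => norm_nonneg _)
            hmaj ((ae_restrict_mem measurableSet_Ioi).mono hbd)
      _ = C * K * 2 * t ^ (-(1 / 2) : ℝ) := by
          rw [integral_const_mul, integral_add_rpow (by norm_num) ht]; norm_num; ring

end

/-! ### Fubini: the time integral in frequency space and the convolution. -/

section

open MeasureTheory Set Filter Topology
open scoped SchwartzMap

variable {n : ℕ} {lv : Fin n → ℕ} {ℓ : EuclideanSpace ℝ (Fin n) → ℂ}

lemma ae_ne_zero (hn : 0 < n) : ∀ᵐ z : EuclideanSpace ℝ (Fin n), z ≠ 0 := by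
  have : Nonempty (Fin n) := ⟨⟨0, hn⟩⟩
  have : Nontrivial (EuclideanSpace ℝ (Fin n)) := inferInstance
  exact Measure.ae_ne volume 0

lemma integral_sigmaPow_damp (ℓ : EuclideanSpace ℝ (Fin n) → ℂ)
    {z : EuclideanSpace ℝ (Fin n)} (hz : z ≠ 0) :
    ∫ t in Ioi (0 : ℝ), sigmaPow lv ℓ 1 z * damp lv t z = ℓ z := by
  have hσ := sigma_pos lv hz
  have h := Real.integral_rpow_mul_exp_neg_mul_Ioi (a := 1) one_pos hσ
  simp only [sub_self, Real.rpow_zero, one_mul, Real.rpow_one, Real.Gamma_one, mul_one] at h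
  have e : ∀ t : ℝ, damp lv t z = ((Real.exp (-(sigma lv z * t)) : ℝ) : ℂ) := fun t => by
    rw [damp, mul_comm]
  simp_rw [e]
  rw [integral_const_mul, integral_complex_ofReal, h, sigmaPow, pow_one]
  have hσ' : (sigma lv z : ℂ) ≠ 0 := by exact_mod_cast hσ.ne'
  push_cast
  field_simp

lemma sigma_le_sum_norm_pow (lv : Fin n → ℕ) (z : EuclideanSpace ℝ (Fin n)) :
    sigma lv z ≤ ∑ k, ‖z‖ ^ (2 * lv k) := by
  refine Finset.sum_le_sum fun k _ => ?_
  calc z k ^ (2 * lv k) = ‖z k‖ ^ (2 * lv k) := by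
        rw [Real.norm_eq_abs, pow_mul, pow_mul, sq_abs]
    _ ≤ _ := by gcongr; exact PiLp.norm_apply_le z k

section

variable {V : Type*} [NormedAddCommGroup V] [NormedSpace ℝ V]

/-- `σℓ` is O(σ^{1/2}), hence O(1 + σ), of polynomial growth. Domination of ψ by ‖z‖^p ‖S‖ is
assumed, not that ψ is Schwartz, so that ψ may carry the nonsmooth weight ‖z‖^p in moment estimates.
-/
lemma IsInvHom.integrable_sigmaPow_mul (hlv : ∀ k, 0 < lv k) (hℓ : IsInvHom lv ℓ)
    (S : 𝓢(EuclideanSpace ℝ (Fin n), V)) (p : ℕ) {ψ : EuclideanSpace ℝ (Fin n) → ℂ}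
    (hψm : Measurable ψ) (hψ : ∀ z, ‖ψ z‖ ≤ ‖z‖ ^ p * ‖S z‖) :
    Integrable fun z => sigmaPow lv ℓ 1 z * ψ z := by
  have hh := hℓ.isHom hlv 0
  obtain ⟨C, hC0, hC⟩ := hh.exists_bound hlv (deg_pos hlv 0)
  have hW : (0 : ℝ) < totalWt lv := by exact_mod_cast totalWt_pos hlv
  have hi : Integrable fun z => C * (‖z‖ ^ p * ‖S z‖ +
      ∑ k, ‖z‖ ^ (2 * lv k + p) * ‖S z‖) :=
    ((S.integrable_pow_mul volume p).add (integrable_finsetSum _ fun k _ =>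
      S.integrable_pow_mul volume (2 * lv k + p))).const_mul C
  refine hi.mono' (hh.measurable.mul hψm).aestronglyMeasurable (ae_of_all _ fun z => ?_)
  have hσ := sigma_nonneg lv z
  have h1 : ‖sigmaPow lv ℓ 1 z‖ ≤ C * (1 + sigma lv z) := by
    refine (hC z).trans ?_
    gcongr
    rcases le_total (sigma lv z) 1 with h | h
    · have := Real.rpow_le_one hσ h (z := ((2 * 0 + 1) * totalWt lv : ℕ) / (2 * totalWt lv))
        (by positivity)
      linarith
    · have := Real.rpow_le_rpow_of_exponent_le h
        (y := ((2 * 0 + 1) * totalWt lv : ℕ) / (2 * (totalWt lv : ℝ))) (z := 1) (by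
          rw [div_le_one (by positivity)]; push_cast; linarith)
      rw [Real.rpow_one] at this
      linarith
  rw [norm_mul]
  calc ‖sigmaPow lv ℓ 1 z‖ * ‖ψ z‖
      ≤ (C * (1 + ∑ k, ‖z‖ ^ (2 * lv k))) * (‖z‖ ^ p * ‖S z‖) := by
        gcongr
        · refine h1.trans ?_
          gcongr
          exact sigma_le_sum_norm_pow lv z
        · exact hψ z
    _ = _ := by
        simp only [pow_add, mul_assoc, ← Finset.sum_mul]; ring

/-- Integrating the kernel in time recovers `ℓ` in frequency space. -/
lemma IsInvHom.integral_time (hlv : ∀ k, 0 < lv k) (hn : 0 < n) (hdim : totalWt lv < homDim lv)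
    (hℓ : IsInvHom lv ℓ) (S : 𝓢(EuclideanSpace ℝ (Fin n), V)) (p : ℕ)
    {ψ : EuclideanSpace ℝ (Fin n) → ℂ}
    (hψm : Measurable ψ) (hψ : ∀ z, ‖ψ z‖ ≤ ‖z‖ ^ p * ‖S z‖) :
    Integrable (fun z => ℓ z * ψ z) ∧ ∀ x,
      ∫ t in Ioi (0 : ℝ), ∫ z, phase x z * (sigmaPow lv ℓ 1 z * damp lv t z) * ψ z =
        ∫ z, phase x z * (ℓ z * ψ z) := by
  have hh := hℓ.isHom hlv 0
  obtain ⟨C, hC0, hC⟩ := hh.exists_integral_damp_le hlv (deg_pos hlv 0)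
  obtain ⟨B, hB⟩ := S.decay p 0
  simp only [norm_iteratedFDeriv_zero] at hB
  have hψB : ∀ z, ‖ψ z‖ ≤ B := fun z => (hψ z).trans (hB.2 z)
  have hi := hℓ.integrable_sigmaPow_mul hlv S p hψm hψ
  have hmeas : Measurable fun q : ℝ × EuclideanSpace ℝ (Fin n) =>
      sigmaPow lv ℓ 1 q.2 * damp lv q.1 q.2 * ψ q.2 :=
    ((hh.measurable.comp measurable_snd).mul
      (measurable_damp_comp lv measurable_fst measurable_snd)).mul (hψm.comp measurable_snd)
  have hit : ∀ t : ℝ, 0 < t → Integrable fun z => sigmaPow lv ℓ 1 z * damp lv t z * ψ z :=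
    fun t ht => (hh.integrable_damp hlv (deg_pos hlv 0) ht).mul_bdd (c := B)
      hψm.aestronglyMeasurable (ae_of_all _ hψB)
  have hint : Integrable (fun q : ℝ × EuclideanSpace ℝ (Fin n) =>
      sigmaPow lv ℓ 1 q.2 * damp lv q.1 q.2 * ψ q.2) ((volume.restrict (Ioi 0)).prod volume) := by
    rw [integrable_prod_iff hmeas.aestronglyMeasurable]
    constructor
    · exact (ae_restrict_mem measurableSet_Ioi).mono fun t ht => hit t ht
    -- Near t = 0 the damping is at most 1 and `σℓψ` is integrable; for large t, ψ is bounded and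
    -- the decay of the damped integral suffices.
    · refine integrableOn_Ioi_of_rpow_bounds (a := 0) (b := decay lv (totalWt lv))
        (A := ∫ z, ‖sigmaPow lv ℓ 1 z * ψ z‖) (B := B * C)
        (hmeas.norm.stronglyMeasurable.integral_prod_right).aestronglyMeasurable
        zero_lt_one (one_lt_decay hlv hdim) ?_ ?_
      · intro t ht
        rw [Real.norm_of_nonneg (integral_nonneg fun _ => norm_nonneg _), neg_zero,
          Real.rpow_zero, mul_one]
        refine integral_mono (hit t ht).norm hi.norm fun z => ?_
        simp only [norm_mul, norm_damp]
        have : Real.exp (-(t * sigma lv z)) ≤ 1 := by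
          rw [Real.exp_le_one_iff]
          have := mul_nonneg ht.le (sigma_nonneg lv z)
          linarith
        calc _ ≤ ‖sigmaPow lv ℓ 1 z‖ * 1 * ‖ψ z‖ := by gcongr
          _ = _ := by ring
      · intro t ht
        rw [Real.norm_of_nonneg (integral_nonneg fun _ => norm_nonneg _)]
        have hB0 : 0 ≤ B := hB.1.le
        calc ∫ z, ‖sigmaPow lv ℓ 1 z * damp lv t z * ψ z‖
            ≤ ∫ z, B * ‖sigmaPow lv ℓ 1 z * damp lv t z‖ := by
              refine integral_mono (hit t ht).norm
                ((hh.integrable_damp hlv (deg_pos hlv 0) ht).norm.const_mul B) fun z => ?_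
              simp only [norm_mul _ (ψ z)]
              rw [mul_comm]
              gcongr
              exact hψB z
          _ ≤ B * C * t ^ (-decay lv (totalWt lv)) := by
              rw [integral_const_mul, mul_assoc]
              gcongr
              simpa using hC t ht
  have hinner : ∀ z, z ≠ 0 → ∫ t in Ioi (0 : ℝ), sigmaPow lv ℓ 1 z * damp lv t z * ψ z =
      ℓ z * ψ z := fun z hz => by
    rw [integral_mul_const, integral_sigmaPow_damp ℓ hz]
  -- Fubini also yields the integrability of ℓψ, in spite of the singularity of ℓ at the origin.
  refine ⟨hint.integral_prod_right.congr ((ae_ne_zero hn).mono hinner), fun x => ?_⟩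
  have hintx : Integrable (fun q : ℝ × EuclideanSpace ℝ (Fin n) =>
      phase x q.2 * (sigmaPow lv ℓ 1 q.2 * damp lv q.1 q.2) * ψ q.2)
      ((volume.restrict (Ioi 0)).prod volume) := by
    refine (hint.bdd_mul (c := 1) (f := fun q : ℝ × EuclideanSpace ℝ (Fin n) => phase x q.2)
      (measurable_phase_comp measurable_const measurable_snd).aestronglyMeasurable
      (ae_of_all _ fun q => by simp)).congr (ae_of_all _ fun q => ?_)
    simp only []
    ring
  rw [integral_integral_swap (f := fun (t : ℝ) (z : EuclideanSpace ℝ (Fin n)) =>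
    phase x z * (sigmaPow lv ℓ 1 z * damp lv t z) * ψ z) hintx]
  refine integral_congr_ae ((ae_ne_zero hn).mono fun z hz => ?_)
  simp only []
  rw [← hinner z hz, ← integral_const_mul]
  congr 1; ext t; ring

end

/-- The Fourier transform with the normalization `∫ e^{-iy·z} φ(y) dy`. -/
def ftrans {V : Type*} [NormedAddCommGroup V] [NormedSpace ℂ V]
    (φ : EuclideanSpace ℝ (Fin n) → V) (z : EuclideanSpace ℝ (Fin n)) : V :=
  ∫ y, phase (-y) z • φ y

/-- Convolution with the kernel, written in frequency space for each time. -/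
lemma IsInvHom.integral_conv (hlv : ∀ k, 0 < lv k) (hn : 0 < n) (hdim : totalWt lv < homDim lv)
    (hℓ : IsInvHom lv ℓ) {φ : EuclideanSpace ℝ (Fin n) → ℂ} (hφ : Continuous φ)
    (hφc : HasCompactSupport φ) (x : EuclideanSpace ℝ (Fin n)) :
    Integrable (fun y => (∫ t in Ioi (0 : ℝ), osc lv (sigmaPow lv ℓ 1) (x - y) t) * φ y) ∧
      ∫ y, (∫ t in Ioi (0 : ℝ), osc lv (sigmaPow lv ℓ 1) (x - y) t) * φ y =
        ∫ t in Ioi (0 : ℝ), ∫ z, phase x z * (sigmaPow lv ℓ 1 z * damp lv t z) * ftrans φ z := by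
  have hh := hℓ.isHom hlv 0
  have hφi : Integrable φ := hφ.integrable_of_hasCompactSupport hφc
  obtain ⟨M, hM⟩ := hφc.exists_bound_of_continuous hφ
  have hM0 : 0 ≤ M := (norm_nonneg _).trans (hM 0)
  obtain ⟨B, hB0, hB⟩ := hℓ.exists_osc_one_bound hlv
  obtain ⟨C, hC0, hC⟩ := hℓ.exists_integral_osc_le hlv hn
  have hmeas : Measurable fun q : ℝ × EuclideanSpace ℝ (Fin n) =>
      osc lv (sigmaPow lv ℓ 1) (x - q.2) q.1 * φ q.2 :=
    (hh.measurable_osc (measurable_const.sub measurable_snd) measurable_fst).mul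
      (hφ.measurable.comp measurable_snd)
  have hosc : ∀ t : ℝ, 0 < t → Integrable fun y => osc lv (sigmaPow lv ℓ 1) (x - y) t :=
    fun t ht => (hC t ht).1.comp_sub_left x
  have hit : ∀ t : ℝ, 0 < t → Integrable fun y => osc lv (sigmaPow lv ℓ 1) (x - y) t * φ y :=
    fun t ht => (hosc t ht).mul_bdd (c := M) hφ.aestronglyMeasurable (ae_of_all _ hM)
  have hint : Integrable (fun q : ℝ × EuclideanSpace ℝ (Fin n) =>
      osc lv (sigmaPow lv ℓ 1) (x - q.2) q.1 * φ q.2)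
      ((volume.restrict (Ioi 0)).prod volume) := by
    rw [integrable_prod_iff hmeas.aestronglyMeasurable]
    constructor
    · exact (ae_restrict_mem measurableSet_Ioi).mono fun t ht => hit t ht
    -- Near t = 0: L¹ norm of the kernel times the maximum of φ. For large t: maximum of the kernel
    -- times the L¹ norm of φ.
    · refine integrableOn_Ioi_of_rpow_bounds (a := 1 / 2) (b := decay lv (totalWt lv))
        (A := M * C) (B := B * ∫ y, ‖φ y‖)
        (hmeas.norm.stronglyMeasurable.integral_prod_right).aestronglyMeasurable
        (by norm_num) (one_lt_decay hlv hdim) ?_ ?_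
      · intro t ht
        rw [Real.norm_of_nonneg (integral_nonneg fun _ => norm_nonneg _)]
        calc ∫ y, ‖osc lv (sigmaPow lv ℓ 1) (x - y) t * φ y‖
            ≤ ∫ y, M * ‖osc lv (sigmaPow lv ℓ 1) (x - y) t‖ := by
              refine integral_mono (hit t ht).norm ((hosc t ht).norm.const_mul M) fun y => ?_
              simp only [norm_mul]
              rw [mul_comm]
              gcongr
              exact hM y
          _ = M * ∫ y, ‖osc lv (sigmaPow lv ℓ 1) y t‖ := by
              rw [integral_const_mul,
                integral_sub_left_eq_self (fun y => ‖osc lv (sigmaPow lv ℓ 1) y t‖) volume x]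
          _ ≤ M * C * t ^ (-(1 / 2) : ℝ) := by
              rw [mul_assoc]; gcongr; exact (hC t ht).2
      · intro t ht
        rw [Real.norm_of_nonneg (integral_nonneg fun _ => norm_nonneg _)]
        calc ∫ y, ‖osc lv (sigmaPow lv ℓ 1) (x - y) t * φ y‖
            ≤ ∫ y, (B * t ^ (-decay lv (totalWt lv))) * ‖φ y‖ := by
              refine integral_mono (hit t ht).norm (hφi.norm.const_mul _) fun y => ?_
              simp only [norm_mul]
              gcongr
              exact hB _ t ht
          _ = _ := by rw [integral_const_mul]; ring
  have e0 : ∀ y, (∫ t in Ioi (0 : ℝ), osc lv (sigmaPow lv ℓ 1) (x - y) t) * φ y =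
      ∫ t in Ioi (0 : ℝ), osc lv (sigmaPow lv ℓ 1) (x - y) t * φ y := fun y =>
    (integral_mul_const _ _).symm
  simp_rw [e0]
  refine ⟨hint.integral_prod_right, ?_⟩
  rw [← integral_integral_swap (f := fun (t : ℝ) (y : EuclideanSpace ℝ (Fin n)) =>
    osc lv (sigmaPow lv ℓ 1) (x - y) t * φ y) hint]
  refine setIntegral_congr_fun measurableSet_Ioi fun t ht => ?_
  have hid : Integrable fun z => sigmaPow lv ℓ 1 z * damp lv t z :=
    hh.integrable_damp hlv (deg_pos hlv 0) ht
  have hyz : Integrable (fun q : EuclideanSpace ℝ (Fin n) × EuclideanSpace ℝ (Fin n) =>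
      phase (x - q.1) q.2 * (sigmaPow lv ℓ 1 q.2 * damp lv t q.2) * φ q.1)
      (volume.prod volume) := by
    refine ((hφi.mul_prod hid).bdd_mul (c := 1)
      (f := fun q : EuclideanSpace ℝ (Fin n) × EuclideanSpace ℝ (Fin n) => phase (x - q.1) q.2)
      (measurable_phase_comp (measurable_const.sub measurable_fst)
        measurable_snd).aestronglyMeasurable
      (ae_of_all _ fun q => by simp)).congr (ae_of_all _ fun q => ?_)
    simp only []
    ring
  have e1 : ∀ y, osc lv (sigmaPow lv ℓ 1) (x - y) t * φ y =
      ∫ z, phase (x - y) z * (sigmaPow lv ℓ 1 z * damp lv t z) * φ y := fun y =>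
    (integral_mul_const _ _).symm
  simp only [e1]
  rw [integral_integral_swap (f := fun y z : EuclideanSpace ℝ (Fin n) =>
    phase (x - y) z * (sigmaPow lv ℓ 1 z * damp lv t z) * φ y) hyz]
  congr 1; ext z
  rw [ftrans, ← integral_const_mul]
  congr 1; ext y
  rw [phase_sub, smul_eq_mul]; ring

end

/-! ### Inverse transforms, derivatives and Fourier inversion. -/

section

open MeasureTheory Set Filter Topology
open scoped SchwartzMap FourierTransform

variable {n m : ℕ} {V : Type*} [NormedAddCommGroup V]

/-- All moments of `G` are finite. -/
def HasMoments (G : EuclideanSpace ℝ (Fin n) → V) : Prop :=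
  AEStronglyMeasurable G ∧ ∀ p : ℕ, Integrable fun z => ‖z‖ ^ p * ‖G z‖

lemma HasMoments.integrable {G : EuclideanSpace ℝ (Fin n) → V} (hG : HasMoments G) :
    Integrable G := by
  have := hG.2 0
  simp only [pow_zero, one_mul] at this
  exact (integrable_norm_iff hG.1).1 this

variable [NormedSpace ℂ V]

/-- The unnormalized inverse Fourier transform `∫ e^{ix·z} G(z) dz`. -/
def itrans (G : EuclideanSpace ℝ (Fin n) → V) (x : EuclideanSpace ℝ (Fin n)) : V :=
  ∫ z, phase x z • G z

lemma HasMoments.coord_smul {G : EuclideanSpace ℝ (Fin n) → V} (hG : HasMoments G) (k : Fin n) :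
    HasMoments fun z => (Complex.I * (z k : ℂ)) • G z := by
  have hc : Continuous fun z : EuclideanSpace ℝ (Fin n) => Complex.I * (z k : ℂ) :=
    continuous_const.mul (Complex.continuous_ofReal.comp
      (contDiff_coord (N := 0) k).continuous)
  have hm := hc.aestronglyMeasurable (μ := volume).smul hG.1
  refine ⟨hm, fun p => (hG.2 (p + 1)).mono'
    ((by fun_prop : Continuous fun z : EuclideanSpace ℝ (Fin n) => ‖z‖ ^ p).aestronglyMeasurable.mul
      hm.norm) (ae_of_all _ fun z => ?_)⟩
  have : ‖z k‖ ≤ ‖z‖ := PiLp.norm_apply_le z k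
  rw [Real.norm_of_nonneg (by positivity), norm_smul, norm_mul, Complex.norm_I, one_mul,
    Complex.norm_real, pow_succ, mul_assoc]
  gcongr

lemma phase_smul_integrable {G : EuclideanSpace ℝ (Fin n) → V} (hG : Integrable G)
    (x : EuclideanSpace ℝ (Fin n)) : Integrable fun z => phase x z • G z :=
  hG.bdd_smul 1 (continuous_phase_right x).aestronglyMeasurable
    (ae_of_all _ fun z => (norm_phase x z).le)

/-- The pairing for which `itrans` is a Fourier integral. -/
def pairing (n : ℕ) :
    EuclideanSpace ℝ (Fin n) →L[ℝ] EuclideanSpace ℝ (Fin n) →L[ℝ] ℝ :=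
  -- The factor cancels the -2π in the exponent of the standard Fourier integral.
  -(2 * Real.pi)⁻¹ • innerSL ℝ

lemma pairing_apply (z x : EuclideanSpace ℝ (Fin n)) :
    pairing n z x = -(2 * Real.pi)⁻¹ * ∑ k, x k * z k := by
  rw [pairing, _root_.smul_apply, _root_.smul_apply,
    innerSL_apply_apply, PiLp.inner_apply]
  simp

lemma fourierChar_pairing (x z : EuclideanSpace ℝ (Fin n)) :
    ((Real.fourierChar (-(pairing n z x)) : Circle) : ℂ) = phase x z := by
  rw [Real.fourierChar_apply, pairing_apply, phase]
  congr 1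
  have : (Real.pi : ℂ) ≠ 0 := by exact_mod_cast Real.pi_ne_zero
  push_cast
  field_simp

lemma itrans_eq_fourierIntegral (G : EuclideanSpace ℝ (Fin n) → V) :
    itrans G = VectorFourier.fourierIntegral Real.fourierChar volume (pairing n).toLinearMap₁₂ G := by
  ext x
  simp only [itrans, VectorFourier.fourierIntegral]
  congr 1; ext z
  rw [Circle.smul_def]
  congr 1
  exact (fourierChar_pairing x z).symm

lemma HasMoments.contDiff_itrans {G : EuclideanSpace ℝ (Fin n) → V} (hG : HasMoments G) :
    ContDiff ℝ ∞ (itrans G) := by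
  rw [itrans_eq_fourierIntegral]
  exact VectorFourier.contDiff_fourierIntegral (pairing n) (N := ⊤) fun p _ => hG.2 p

lemma HasMoments.lineDeriv_itrans [CompleteSpace V] {G : EuclideanSpace ℝ (Fin n) → V}
    (hG : HasMoments G)
    (k : Fin n) (x : EuclideanSpace ℝ (Fin n)) :
    lineDeriv ℝ (itrans G) x (EuclideanSpace.single k (1 : ℝ)) =
      itrans (fun z => (Complex.I * (z k : ℂ)) • G z) x := by
  have h1 := hG.2 1
  simp only [pow_one] at h1
  have hd := VectorFourier.hasFDerivAt_fourierIntegral (pairing n) hG.integrable h1 x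
  rw [← itrans_eq_fourierIntegral] at hd
  have hi : Integrable (VectorFourier.fourierSMulRight (pairing n) G) := by
    refine (h1.const_mul (2 * Real.pi * ‖pairing n‖)).mono' hG.1.fourierSMulRight
      (ae_of_all _ fun z => ?_)
    rw [← mul_assoc]
    exact VectorFourier.norm_fourierSMulRight_le (pairing n) G z
  rw [(hd.hasLineDerivAt _).lineDeriv, Real.fourierIntegral_continuousLinearMap_apply' hi,
    itrans_eq_fourierIntegral]
  congr 1; ext z
  rw [VectorFourier.fourierSMulRight_apply, pairing_apply, ← Complex.coe_smul, smul_smul]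
  congr 1
  have : (Real.pi : ℂ) ≠ 0 := by exact_mod_cast Real.pi_ne_zero
  simp
  field_simp

lemma HasMoments.iterate_pderiv {G : EuclideanSpace ℝ (Fin n) → Fin m → ℂ} (hG : HasMoments G)
    (k : Fin n) (a : ℕ) :
    HasMoments (fun z => (Complex.I * (z k : ℂ)) ^ a • G z) ∧
      (pderiv k)^[a] (itrans G) = itrans fun z => (Complex.I * (z k : ℂ)) ^ a • G z := by
  induction a with
  | zero => simpa using hG
  | succ a ih =>
    have e : (fun z : EuclideanSpace ℝ (Fin n) => (Complex.I * (z k : ℂ)) ^ (a + 1) • G z) =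
        fun z => (Complex.I * (z k : ℂ)) • ((Complex.I * (z k : ℂ)) ^ a • G z) := by
      ext1 z; rw [smul_smul, pow_succ']
    rw [e, Function.iterate_succ_apply', ih.2]
    exact ⟨ih.1.coord_smul k, funext fun x => ih.1.lineDeriv_itrans k x⟩

lemma HasMoments.multiDeriv_itrans {G : EuclideanSpace ℝ (Fin n) → Fin m → ℂ}
    (hG : HasMoments G) (α : Fin n → ℕ) :
    HasMoments (fun z => (∏ k, (Complex.I * (z k : ℂ)) ^ α k) • G z) ∧
      multiDeriv α (itrans G) =
        itrans fun z => (∏ k, (Complex.I * (z k : ℂ)) ^ α k) • G z := by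
  -- `multiDeriv` folds over the list of all coordinates, so the induction runs over arbitrary
  -- lists.
  have key : ∀ L : List (Fin n),
      HasMoments (fun z => (L.map fun k => (Complex.I * (z k : ℂ)) ^ α k).prod • G z) ∧
      L.foldr (fun k v => (pderiv k)^[α k] v) (itrans G) =
        itrans fun z => (L.map fun k => (Complex.I * (z k : ℂ)) ^ α k).prod • G z := by
    intro L
    induction L with
    | nil => simpa using hG
    | cons k L ih =>
      have h := ih.1.iterate_pderiv k (α k)
      simp only [List.foldr_cons, ih.2, List.map_cons, List.prod_cons, mul_smul]
      exact h
  simp only [Fin.prod_univ_def]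
  exact key _

/-- Differentiation under the integral sign, permitted by the moments, turns ∂^α into multiplication
by (iz)^α; summing over α gives the symbol. -/
lemma HasMoments.diffOp_itrans {G : EuclideanSpace ℝ (Fin n) → Fin m → ℂ} (hG : HasMoments G)
    (A : (Fin n → ℕ) →₀ Matrix (Fin m) (Fin m) ℂ) :
    diffOp A (itrans G) = itrans fun z => (symbol A z).mulVec (G z) := by
  ext1 x
  have h1 : ∀ α ∈ A.support, (A α).mulVec (multiDeriv α (itrans G) x) =
      ∫ z, phase x z • (A α).mulVec ((∏ k, (Complex.I * (z k : ℂ)) ^ α k) • G z) := by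
    intro α _
    have h := hG.multiDeriv_itrans α
    rw [h.2]
    have := (Matrix.mulVecLin (A α)).toContinuousLinearMap.integral_comp_comm
      (phase_smul_integrable h.1.integrable x)
    simp only [LinearMap.coe_toContinuousLinearMap', Matrix.mulVecLin_apply,
      Matrix.mulVec_smul] at this
    simp only [itrans, Matrix.mulVec_smul]
    exact this.symm
  have h2 : ∀ α ∈ A.support, Integrable fun z : EuclideanSpace ℝ (Fin n) =>
      phase x z • (A α).mulVec ((∏ k, (Complex.I * (z k : ℂ)) ^ α k) • G z) := by
    intro α _
    have h := hG.multiDeriv_itrans α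
    exact phase_smul_integrable
      ((Matrix.mulVecLin (A α)).toContinuousLinearMap.integrable_comp h.1.integrable) x
  rw [diffOp, Finsupp.sum, Finset.sum_congr rfl h1, ← integral_finsetSum _ h2, itrans]
  congr 1; ext1 z
  rw [← Finset.smul_sum, symbol, Finsupp.sum, Matrix.sum_mulVec]
  congr 1
  refine Finset.sum_congr rfl fun α _ => ?_
  rw [Matrix.mulVec_smul, Matrix.smul_mulVec]

lemma phase_eq_inner (x z : EuclideanSpace ℝ (Fin n)) :
    phase x z = Complex.exp (((inner ℝ z x : ℝ) : ℂ) * Complex.I) := by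
  simp [phase, PiLp.inner_apply, mul_comm]

lemma fourier_inv_smul_eq_ftrans (f : EuclideanSpace ℝ (Fin n) → V)
    (z : EuclideanSpace ℝ (Fin n)) :
    𝓕 f ((2 * Real.pi)⁻¹ • z) = ftrans f z := by
  rw [Real.fourier_eq', ftrans]
  congr 1; ext y
  congr 1
  rw [phase_eq_inner, inner_smul_right, inner_neg_right, real_inner_comm]
  congr 3
  have : Real.pi ≠ 0 := Real.pi_ne_zero
  field_simp

/-- The transform of a test function is a Schwartz function. -/
lemma exists_schwartz_ftrans [CompleteSpace V] {f : EuclideanSpace ℝ (Fin n) → V}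
    (hf : ContDiff ℝ ∞ f)
    (hfc : HasCompactSupport f) :
    ∃ S : 𝓢(EuclideanSpace ℝ (Fin n), V), ∀ z, S z = ftrans f z := by
  have h : (2 * Real.pi)⁻¹ ≠ 0 := by positivity
  refine ⟨SchwartzMap.compCLMOfContinuousLinearEquiv ℝ
    (ContinuousLinearEquiv.smulLeft (Units.mk0 _ h)) (𝓕 (hfc.toSchwartzMap hf)), fun z => ?_⟩
  rw [← fourier_inv_smul_eq_ftrans]
  simp only [SchwartzMap.compCLMOfContinuousLinearEquiv_apply, SchwartzMap.fourier_coe]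
  rfl

/-- Fourier inversion for the transforms `ftrans` and `itrans`. -/
lemma itrans_ftrans [CompleteSpace V] {f : EuclideanSpace ℝ (Fin n) → V} (hf : ContDiff ℝ ∞ f)
    (hfc : HasCompactSupport f) (x : EuclideanSpace ℝ (Fin n)) :
    itrans (ftrans f) x = (((2 * Real.pi) ^ n : ℝ) : ℂ) • f x := by
  have hinv : 𝓕⁻ (𝓕 f) = f := by
    refine Continuous.fourierInv_fourier_eq hf.continuous
      (hf.continuous.integrable_of_hasCompactSupport hfc) ?_
    have := (𝓕 (hfc.toSchwartzMap hf)).integrable (μ := volume)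
    rwa [SchwartzMap.fourier_coe] at this
  have h1 : itrans (ftrans f) x =
      ∫ z, (fun v => phase x ((2 * Real.pi) • v) • 𝓕 f v) ((2 * Real.pi)⁻¹ • z) := by
    rw [itrans]
    congr 1; ext z
    have : (2 * Real.pi) ≠ 0 := by positivity
    simp only [smul_smul, mul_inv_cancel₀ this, one_smul, fourier_inv_smul_eq_ftrans]
  rw [h1, Measure.integral_comp_smul volume
    (fun v => phase x ((2 * Real.pi) • v) • 𝓕 f v), finrank_euclideanSpace_fin, inv_pow, inv_inv,
    abs_of_pos (by positivity), Complex.coe_smul]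
  congr 1
  conv_rhs => rw [← hinv, Real.fourierInv_eq']
  congr 1; ext v
  rw [phase_eq_inner, inner_smul_left]
  simp

end

/-! ### Application to semielliptic operators. -/

section

open MeasureTheory Set Filter Topology
open scoped SchwartzMap

variable {n m : ℕ} {l : ℕ} {lv : Fin n → ℕ} {A : (Fin n → ℕ) →₀ Matrix (Fin m) (Fin m) ℂ}

/-- The integer weights are `γ` multiplied by W/ℓ, which turns conditions on `γ` into conditions on
integers. -/
lemma gam_mul {lv : Fin n → ℕ} (hl : 0 < l) (hlv : ∀ k, 0 < lv k) (k : Fin n) :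
    gam l lv k * totalWt lv = l * wt lv k := by
  have h1 : (lv k : ℚ) ≠ 0 := by exact_mod_cast (hlv k).ne'
  rw [gam, ← wt_mul lv k]
  push_cast
  field_simp

/-- For n = 0 the empty product gives W = 1 and the empty sum Q = 0. -/
lemma dim_pos_of_lt_homDim (hdim : totalWt lv < homDim lv) : 0 < n := by
  rcases Nat.eq_zero_or_pos n with rfl | h
  · simp [homDim] at hdim
  · exact h

namespace IsSemielliptic

lemma sum_mul_wt (hA : IsSemielliptic l lv A) {α : Fin n → ℕ} (hα : A α ≠ 0) :
    ∑ k, wt lv k * α k = totalWt lv := by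
  have hl : (l : ℚ) ≠ 0 := by exact_mod_cast hA.order_pos.ne'
  have h := congrArg (· * (totalWt lv : ℚ)) (hA.weight α hα)
  simp only [Finset.sum_mul, mul_assoc, gam_mul hA.order_pos hA.lv_pos] at h
  have h2 : (l : ℚ) * ∑ k, (wt lv k : ℚ) * α k = l * totalWt lv := by
    rw [← h, Finset.mul_sum]
    exact Finset.sum_congr rfl fun k _ => by ring
  exact_mod_cast mul_left_cancel₀ hl h2

lemma totalWt_lt_homDim (hA : IsSemielliptic l lv A) (hγ : (l : ℚ) < gamNorm l lv) :
    totalWt lv < homDim lv := by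
  have hl : (0 : ℚ) < l := by exact_mod_cast hA.order_pos
  have hW : (0 : ℚ) < totalWt lv := by exact_mod_cast totalWt_pos hA.lv_pos
  have h := mul_lt_mul_of_pos_right hγ hW
  simp only [gamNorm, Finset.sum_mul, gam_mul hA.order_pos hA.lv_pos] at h
  rw [← Finset.mul_sum] at h
  have h2 := lt_of_mul_lt_mul_left h hl.le
  rw [homDim]
  exact_mod_cast h2

lemma symbol_dil (hA : IsSemielliptic l lv A) (r : ℝ) (z : EuclideanSpace ℝ (Fin n)) :
    symbol A (dil lv r z) = (r : ℂ) ^ totalWt lv • symbol A z := by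
  simp only [symbol, Finsupp.sum, Finset.smul_sum]
  refine Finset.sum_congr rfl fun α hα => ?_
  rw [smul_smul, ← hA.sum_mul_wt (Finsupp.mem_support_iff.1 hα), ← Finset.prod_pow_eq_pow_sum,
    ← Finset.prod_mul_distrib]
  congr 1
  refine Finset.prod_congr rfl fun k _ => ?_
  rw [dil_apply, pow_mul, ← mul_pow]
  push_cast
  ring

end IsSemielliptic

lemma contDiff_symbol (A : (Fin n → ℕ) →₀ Matrix (Fin m) (Fin m) ℂ) (i j : Fin m) :
    ContDiff ℝ ∞ fun z => symbol A z i j := by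
  simp only [symbol, Finsupp.sum, Matrix.sum_apply, Matrix.smul_apply, smul_eq_mul]
  refine ContDiff.sum fun α _ => ContDiff.mul (contDiff_prod fun k _ => ContDiff.pow ?_ _)
    contDiff_const
  exact contDiff_const.mul (Complex.ofRealCLM.contDiff.comp (contDiff_coord k))

lemma contDiff_det {E : Type*} [NormedAddCommGroup E] [NormedSpace ℝ E]
    {M : E → Matrix (Fin m) (Fin m) ℂ} (hM : ∀ i j, ContDiff ℝ ∞ fun z => M z i j) :
    ContDiff ℝ ∞ fun z => (M z).det := by
  simp only [Matrix.det_apply']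
  exact ContDiff.sum fun σ _ => contDiff_const.mul (contDiff_prod fun i _ => hM _ _)

lemma contDiff_adjugate {E : Type*} [NormedAddCommGroup E] [NormedSpace ℝ E]
    {M : E → Matrix (Fin m) (Fin m) ℂ} (hM : ∀ i j, ContDiff ℝ ∞ fun z => M z i j)
    (i j : Fin m) : ContDiff ℝ ∞ fun z => (M z).adjugate i j := by
  simp only [Matrix.adjugate_apply]
  refine contDiff_det fun a b => ?_
  simp only [Matrix.updateRow_apply]
  split_ifs
  · exact contDiff_const
  · exact hM a b

/-- Smoothness comes from Cramer's rule, the determinant being nonzero off the origin; the scaling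
comes from inverting `symbol_dil`. -/
lemma IsSemielliptic.isInvHom (hA : IsSemielliptic l lv A) (i j : Fin m) :
    IsInvHom lv fun z => (symbol A z)⁻¹ i j where
  smooth := by
    have h : (fun z => (symbol A z)⁻¹ i j) =
        fun z => (symbol A z).det⁻¹ * (symbol A z).adjugate i j := by
      ext1 z
      rw [Matrix.inv_def, Ring.inverse_eq_inv', Matrix.smul_apply, smul_eq_mul]
    rw [h]
    refine ContDiffOn.mul (ContDiffOn.inv (contDiff_det (contDiff_symbol A)).contDiffOn
      fun z hz => ?_) (contDiff_adjugate (contDiff_symbol A) i j).contDiffOn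
    exact ((Matrix.isUnit_iff_isUnit_det _).1 (hA.symbol_isUnit z hz)).ne_zero
  hom r hr z hz := by
    have hr' : ((r : ℂ) ^ totalWt lv) ≠ 0 := pow_ne_zero _ (by exact_mod_cast hr.ne')
    have hdet := (Matrix.isUnit_iff_isUnit_det _).1 (hA.symbol_isUnit z hz)
    have h1 : symbol A (dil lv r z) * (((r : ℂ) ^ totalWt lv)⁻¹ • (symbol A z)⁻¹) = 1 := by
      rw [hA.symbol_dil, Matrix.smul_mul, Matrix.mul_smul, smul_smul, mul_inv_cancel₀ hr',
        one_smul, Matrix.mul_nonsing_inv _ hdet]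
    rw [Matrix.inv_eq_right_inv h1, Matrix.smul_apply, smul_eq_mul, ← mul_assoc,
      mul_inv_cancel₀ hr', one_mul]

lemma kernelIntegrand_apply (lv : Fin n → ℕ) (A : (Fin n → ℕ) →₀ Matrix (Fin m) (Fin m) ℂ)
    (x : EuclideanSpace ℝ (Fin n)) (t : ℝ) (z : EuclideanSpace ℝ (Fin n)) (i j : Fin m) :
    kernelIntegrand lv A x t z i j =
      phase x z * (sigmaPow lv (fun z => (symbol A z)⁻¹ i j) 1 z * damp lv t z) := by
  simp only [kernelIntegrand, Matrix.smul_apply, smul_eq_mul, phase, sigmaPow, damp, pow_one]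
  push_cast
  ring

lemma kernelJ_apply (lv : Fin n → ℕ) (A : (Fin n → ℕ) →₀ Matrix (Fin m) (Fin m) ℂ)
    (x : EuclideanSpace ℝ (Fin n)) (t : ℝ) (i j : Fin m) :
    kernelJ lv A x t i j = osc lv (sigmaPow lv (fun z => (symbol A z)⁻¹ i j) 1) x t := by
  simp only [kernelJ, Matrix.of_apply, kernelIntegrand_apply, osc]

lemma fundSol_apply (lv : Fin n → ℕ) (A : (Fin n → ℕ) →₀ Matrix (Fin m) (Fin m) ℂ)
    (x : EuclideanSpace ℝ (Fin n)) (i j : Fin m) :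
    fundSol lv A x i j = (((2 * Real.pi) ^ n : ℝ) : ℂ)⁻¹ *
      ∫ t in Ioi (0 : ℝ), osc lv (sigmaPow lv (fun z => (symbol A z)⁻¹ i j) 1) x t := by
  simp only [fundSol, Matrix.of_apply, kernelJ_apply]

lemma ftrans_apply {f : EuclideanSpace ℝ (Fin n) → Fin m → ℂ} (hf : Integrable f)
    (z : EuclideanSpace ℝ (Fin n)) (j : Fin m) :
    ftrans f z j = ftrans (fun y => f y j) z := by
  have hi : Integrable fun y => phase (-y) z • f y :=
    hf.bdd_smul 1 (measurable_phase_comp measurable_neg measurable_const).aestronglyMeasurable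
      (ae_of_all _ fun y => (norm_phase _ _).le)
  rw [ftrans, eval_integral fun i => hi.eval i]
  rfl

/-- The Fourier transform of the solution, up to normalization. -/
def solTransform (A : (Fin n → ℕ) →₀ Matrix (Fin m) (Fin m) ℂ)
    (f : EuclideanSpace ℝ (Fin n) → Fin m → ℂ) (z : EuclideanSpace ℝ (Fin n)) : Fin m → ℂ :=
  (((2 * Real.pi) ^ n : ℝ) : ℂ)⁻¹ • (symbol A z)⁻¹.mulVec (ftrans f z)

section

variable {f : EuclideanSpace ℝ (Fin n) → Fin m → ℂ}

/-- Both uses of Fubini meet here, entry by entry: in space for the convolution, then in time for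
`L⁻¹`. -/
lemma IsSemielliptic.integral_entry (hA : IsSemielliptic l lv A) (hγ : (l : ℚ) < gamNorm l lv)
    (hf : ContDiff ℝ ∞ f) (hfc : HasCompactSupport f) (x : EuclideanSpace ℝ (Fin n))
    (i j : Fin m) :
    Integrable (fun y => fundSol lv A (x - y) i j * f y j) ∧
      Integrable (fun z => (symbol A z)⁻¹ i j * ftrans f z j) ∧
      ∫ y, fundSol lv A (x - y) i j * f y j = (((2 * Real.pi) ^ n : ℝ) : ℂ)⁻¹ *
        ∫ z, phase x z * ((symbol A z)⁻¹ i j * ftrans f z j) := by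
  have hdim := hA.totalWt_lt_homDim hγ
  have hn := dim_pos_of_lt_homDim hdim
  have hℓ := hA.isInvHom i j
  have hfj : Continuous fun y => f y j := (continuous_apply j).comp hf.continuous
  have hfjc : HasCompactSupport fun y => f y j :=
    hfc.comp_left (g := fun v : Fin m → ℂ => v j) rfl
  obtain ⟨S, hS⟩ := exists_schwartz_ftrans hf hfc
  have hfi := hf.continuous.integrable_of_hasCompactSupport (μ := volume) hfc
  have hm : Measurable fun z => ftrans f z j := by
    simp only [← hS]
    exact ((continuous_apply j).comp S.continuous).measurable
  have h1 := hℓ.integral_conv hA.lv_pos hn hdim hfj hfjc x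
  have h2 := hℓ.integral_time hA.lv_pos hn hdim S 0 hm (fun z => by
    rw [pow_zero, one_mul, hS]; exact norm_le_pi_norm _ j)
  simp only [fundSol_apply, mul_assoc]
  refine ⟨h1.1.const_mul _, h2.1, ?_⟩
  rw [integral_const_mul, h1.2, ← h2.2 x]
  simp only [← ftrans_apply hfi]

lemma IsSemielliptic.integrable_fundSol_mulVec (hA : IsSemielliptic l lv A)
    (hγ : (l : ℚ) < gamNorm l lv) (hf : ContDiff ℝ ∞ f) (hfc : HasCompactSupport f)
    (x : EuclideanSpace ℝ (Fin n)) :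
    Integrable fun y => (fundSol lv A (x - y)).mulVec (f y) :=
  Integrable.of_eval fun i => integrable_finsetSum Finset.univ fun j _ =>
    (hA.integral_entry hγ hf hfc x i j).1

lemma IsSemielliptic.opS_eq_itrans (hA : IsSemielliptic l lv A)
    (hγ : (l : ℚ) < gamNorm l lv) (hf : ContDiff ℝ ∞ f) (hfc : HasCompactSupport f) :
    opS lv A f = itrans (solTransform A f) := by
  ext x i
  have h := hA.integral_entry hγ hf hfc x i
  have hG : Integrable (solTransform A f) := by
    refine Integrable.of_eval fun i => ?_
    exact (integrable_finsetSum Finset.univ fun j _ =>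
      (hA.integral_entry hγ hf hfc x i j).2.1).const_mul _
  rw [opS, eval_integral fun i => (hA.integrable_fundSol_mulVec hγ hf hfc x).eval i, itrans,
    eval_integral fun i => (phase_smul_integrable hG x).eval i]
  calc ∫ y, (fundSol lv A (x - y)).mulVec (f y) i
      = ∑ j, ∫ y, fundSol lv A (x - y) i j * f y j :=
        integral_finsetSum Finset.univ fun j _ => (h j).1
    _ = ∑ j, ∫ z, (((2 * Real.pi) ^ n : ℝ) : ℂ)⁻¹ *
          (phase x z * ((symbol A z)⁻¹ i j * ftrans f z j)) := by
        refine Finset.sum_congr rfl fun j _ => ?_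
        rw [(h j).2.2, integral_const_mul]
    _ = ∫ z, ∑ j, (((2 * Real.pi) ^ n : ℝ) : ℂ)⁻¹ *
          (phase x z * ((symbol A z)⁻¹ i j * ftrans f z j)) :=
        (integral_finsetSum _ fun j _ => (phase_integrable (h j).2.1 x).const_mul _).symm
    _ = _ := by
        congr 1; ext1 z
        simp only [solTransform, Pi.smul_apply, smul_eq_mul, Matrix.mulVec, dotProduct,
          Finset.mul_sum]
        exact Finset.sum_congr rfl fun j _ => by ring

/-- `L⁻¹` may be singular at the origin, so the product need not be Schwartz; finite moments are
what smoothness of the inverse transform requires. -/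
lemma IsSemielliptic.hasMoments_solTransform (hA : IsSemielliptic l lv A)
    (hγ : (l : ℚ) < gamNorm l lv) (hf : ContDiff ℝ ∞ f) (hfc : HasCompactSupport f) :
    HasMoments (solTransform A f) := by
  have hdim := hA.totalWt_lt_homDim hγ
  have hn := dim_pos_of_lt_homDim hdim
  obtain ⟨S, hS⟩ := exists_schwartz_ftrans hf hfc
  have key : ∀ p : ℕ, Integrable fun z => ((‖z‖ ^ p : ℝ) : ℂ) • solTransform A f z := by
    intro p
    refine Integrable.of_eval fun i => ?_
    have h1 : ∀ j, Integrable fun z => (symbol A z)⁻¹ i j *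
        (((‖z‖ ^ p : ℝ) : ℂ) * ftrans f z j) := fun j => by
      refine ((hA.isInvHom i j).integral_time hA.lv_pos hn hdim S p ?_ fun z => ?_).1
      · simp only [← hS]
        have := S.continuous
        exact (by fun_prop : Continuous fun z => ((‖z‖ ^ p : ℝ) : ℂ) * S z j).measurable
      · rw [norm_mul, Complex.norm_real, Real.norm_of_nonneg (by positivity), hS]
        gcongr
        exact norm_le_pi_norm _ j
    refine ((integrable_finsetSum Finset.univ fun j _ => h1 j).const_mul
      (((2 * Real.pi) ^ n : ℝ) : ℂ)⁻¹).congr (ae_of_all _ fun z => ?_)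
    simp only [solTransform, Pi.smul_apply, smul_eq_mul, Matrix.mulVec, dotProduct,
      Finset.mul_sum]
    exact Finset.sum_congr rfl fun j _ => by ring
  refine ⟨by simpa using (key 0).aestronglyMeasurable, fun p => (key p).norm.congr
    (ae_of_all _ fun z => ?_)⟩
  simp only [norm_smul, Complex.norm_real]
  rw [Real.norm_of_nonneg (by positivity)]

lemma IsSemielliptic.symbol_mulVec_solTransform (hA : IsSemielliptic l lv A)
    {z : EuclideanSpace ℝ (Fin n)} (hz : z ≠ 0) :
    (symbol A z).mulVec (solTransform A f z) =
      (((2 * Real.pi) ^ n : ℝ) : ℂ)⁻¹ • ftrans f z := by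
  rw [solTransform, Matrix.mulVec_smul, Matrix.mulVec_mulVec,
    Matrix.mul_nonsing_inv _ ((Matrix.isUnit_iff_isUnit_det _).1 (hA.symbol_isUnit z hz)),
    Matrix.one_mulVec]

lemma IsSemielliptic.diffOp_opS (hA : IsSemielliptic l lv A)
    (hγ : (l : ℚ) < gamNorm l lv) (hf : ContDiff ℝ ∞ f) (hfc : HasCompactSupport f) :
    diffOp A (opS lv A f) = f := by
  have hdim := hA.totalWt_lt_homDim hγ
  have hn := dim_pos_of_lt_homDim hdim
  rw [hA.opS_eq_itrans hγ hf hfc, (hA.hasMoments_solTransform hγ hf hfc).diffOp_itrans]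
  ext1 x
  have hc : (((2 * Real.pi) ^ n : ℝ) : ℂ) ≠ 0 := by
    exact_mod_cast (by positivity : (2 * Real.pi) ^ n ≠ 0)
  calc itrans (fun z => (symbol A z).mulVec (solTransform A f z)) x
      = ∫ z, (((2 * Real.pi) ^ n : ℝ) : ℂ)⁻¹ • (phase x z • ftrans f z) := by
        -- `L L⁻¹ = 1` is available only off the origin, a null set since n > 0.
        refine integral_congr_ae ((ae_ne_zero hn).mono fun z hz => ?_)
        simp only []
        rw [hA.symbol_mulVec_solTransform hz, smul_comm]
    _ = f x := by
        rw [integral_smul]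
        have := itrans_ftrans hf hfc x
        rw [itrans] at this
        rw [this, smul_smul, inv_mul_cancel₀ hc, one_smul]

end

end

end Semielliptic

end

theorem theorem3p2 {n m : ℕ} (l : ℕ) (lv : Fin n → ℕ)
    (A : (Fin n → ℕ) →₀ Matrix (Fin m) (Fin m) ℂ)
    (hA : Semielliptic.IsSemielliptic l lv A)
    (hγ : (l : ℚ) < Semielliptic.gamNorm l lv) :
    -- the integrals that define `F` converge absolutely
    (∀ (x : EuclideanSpace ℝ (Fin n)) (t : ℝ), 0 < t → ∀ i j,
      MeasureTheory.Integrable (fun z => Semielliptic.kernelIntegrand lv A x t z i j)) ∧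
    (∀ x : EuclideanSpace ℝ (Fin n), x ≠ 0 → ∀ i j,
      MeasureTheory.IntegrableOn (fun t => Semielliptic.kernelJ lv A x t i j) (Set.Ioi 0)) ∧
    -- the convolution with a test function solves the equation
    (∀ f : EuclideanSpace ℝ (Fin n) → Fin m → ℂ, ContDiff ℝ ∞ f → HasCompactSupport f →
      (∀ x, MeasureTheory.Integrable
        (fun y => (Semielliptic.fundSol lv A (x - y)).mulVec (f y))) ∧
      ContDiff ℝ ∞ (Semielliptic.opS lv A f) ∧
      Semielliptic.diffOp A (Semielliptic.opS lv A f) = f) := by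
  refine ⟨fun x t ht i j => ?_, fun x hx i j => ?_, fun f hf hfc => ⟨?_, ?_, ?_⟩⟩
  · simp only [Semielliptic.kernelIntegrand_apply]
    exact Semielliptic.phase_integrable (((hA.isInvHom i j).isHom hA.lv_pos 0).integrable_damp
      hA.lv_pos (Semielliptic.deg_pos hA.lv_pos 0) ht) x
  · simp only [Semielliptic.kernelJ_apply]
    exact (hA.isInvHom i j).integrableOn_osc hA.lv_pos (hA.totalWt_lt_homDim hγ) hx
  · exact hA.integrable_fundSol_mulVec hγ hf hfc
  · rw [hA.opS_eq_itrans hγ hf hfc]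
    exact (hA.hasMoments_solTransform hγ hf hfc).contDiff_itrans
  · exact hA.diffOp_opS hγ hf hfc
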